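/- Let $U$ be a finite-dimensional complex vector superspace with a homogeneous basis $A=A_{\bar 0}\cup A_{\bar 1}$ (even and odd part). Let $F^{ch}_{N=1}$ be the supersymmetric charged free fermion vertex algebra associated to $U$, i.e. the universal enveloping $N_K=1$ SUSY vertex algebra of the SUSY Lie conformal algebra $$R^{ch}_{N=1}=\mathbb C[\partial,D]\otimes(\phi_U\oplus\phi^{\bar U}),\qquad D^2=\partial,\quad \phi_U\simeq U,\quad \phi^{\bar U}\simeq \Pi U^*,$$ where $\phi_U$ and $\phi^{\bar U}$ have the bases $\phi_a$ and $\phi^{\bar a}$ ($a\in A$) and $$[\phi_a{}_\Lambda\phi^{\bar b}]=\delta_{ab},\qquad [\phi_a{}_\Lambda\phi_b]=[\phi^{\bar a}{}_\Lambda\phi^{\bar b}]=0\qquad(a,b\in A).$$ So $\phi_a$ has the parity of $a$ and $\phi^{\bar a}$ the opposite parity. Write $Y(v,z,\theta)=\sum_{j}z^{-j-1}v_{(j|1)}+\theta\sum_j z^{-j-1}v_{(j|0)}$ for the superfields and $uv=u_{(-1|1)}v$ for the normally ordered product. For $(t_a)_{a\in A}\in\mathbb Z^{\dim_{\mathbb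 C}U}$ put $$J^{ch}_{sh}=\sum_{a\in A_{\bar 0}}(D\phi_a)\phi^{\bar a}+\sum_{a\in A_{\bar 1}}(D\phi^{\bar a})\phi_a+\sum_{a\in A_{\bar 0}}t_a\big((D\phi_a)\phi^{\bar a}+\phi_a (D\phi^{\bar a})\big)+\sum_{a\in A_{\bar 1}}t_a\big((D\phi^{\bar a})\phi_a+\phi^{\bar a}(D\phi_a)\big),$$ and for $m\in\mathbb Z$ let $$F^{ch,m}_{N=1}=\{v\in F^{ch}_{N=1} : (J^{ch}_{sh})_{(0|1)}v=m\,v\}$$ be the subspace of elements of charge $m$. Then $$F^{ch}_{N=1}=\bigoplus_{m\in\mathbb Z}F^{ch,m}_{N=1}$$ as a vector space. -/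

import Mathlib

namespace SUSYVA

/-- `(-1)^p` for a parity `p`. -/
def sgn (p : ZMod 2) : ℂ := if p = 0 then 1 else -1

/-- Multiplication by `z - w` on formal distributions
`∑ f m n z^(-m-1) w^(-n-1)` in two even indeterminates, in terms of coefficients. -/
def mulSub {M : Type*} [AddCommGroup M] [Module ℂ M] : Module.End ℂ (ℤ → ℤ → M) where
  toFun f := fun m n => f (m + 1) n - f m (n + 1)
  map_add' f g := by funext m n; simp only [Pi.add_apply]; abel
  map_smul' c f := by
    funext m n; simp only [Pi.smul_apply, RingHom.id_apply, smul_sub]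

section general

variable {V : Type*} [AddCommGroup V] [Module ℂ V]

/-- The coefficients of `X(z) Y(w) - ε Y(w) X(z)`. -/
def scomm (ε : ℂ) (X Y : ℤ → Module.End ℂ V) : ℤ → ℤ → Module.End ℂ V :=
  fun m n => X m * Y n - ε • (Y n * X m)

/-- `(z - w)^N (X(z) Y(w) - ε Y(w) X(z)) = 0` for some `N`. -/
def IsLocal (ε : ℂ) (X Y : ℤ → Module.End ℂ V) : Prop :=
  ∃ N : ℕ, (mulSub ^ N) (scomm ε X Y) = 0

theorem sgn_add (p q : ZMod 2) : sgn (p + q) = sgn p * sgn q := by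
  have h : ∀ p q : ZMod 2, (p + q = 0 ↔ (p = 0 ↔ q = 0)) := by decide
  unfold sgn
  simp only [h]
  by_cases hp : p = 0 <;> by_cases hq : q = 0 <;> simp [hp, hq]

theorem sgn_mul_self (p : ZMod 2) : sgn p * sgn p = 1 := by
  unfold sgn
  split <;> simp

@[simp] theorem sgn_zero : sgn 0 = 1 := by simp [sgn]

@[simp] theorem sgn_one : sgn 1 = -1 := by simp [sgn]

theorem mulSub_apply {M : Type*} [AddCommGroup M] [Module ℂ M] (f : ℤ → ℤ → M) (m n : ℤ) :
    mulSub f m n = f (m + 1) n - f m (n + 1) := rfl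

theorem mulSub_pow_map {M M' : Type*} [AddCommGroup M] [Module ℂ M] [AddCommGroup M']
    [Module ℂ M'] (φ : M →ₗ[ℂ] M') (N : ℕ) (f : ℤ → ℤ → M) :
    (mulSub ^ N) (fun m n => φ (f m n)) = fun m n => φ ((mulSub ^ N) f m n) := by
  induction N generalizing f with
  | zero => rfl
  | succ N ih =>
    rw [pow_succ, pow_succ, Module.End.mul_apply, Module.End.mul_apply, ← ih]
    congr 1
    funext m n
    simp only [mulSub_apply, map_sub]

theorem mulSub_pow_mono {M : Type*} [AddCommGroup M] [Module ℂ M] {f : ℤ → ℤ → M} {N N' : ℕ}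
    (h : N ≤ N') (hf : (mulSub ^ N) f = 0) : (mulSub ^ N') f = 0 := by
  obtain ⟨k, rfl⟩ := Nat.exists_eq_add_of_le h
  rw [add_comm, pow_add, Module.End.mul_apply, hf, map_zero]

theorem mulSub_pow_swap {M : Type*} [AddCommGroup M] [Module ℂ M] (f : ℤ → ℤ → M) (N : ℕ) :
    (mulSub ^ N) (fun m n => f n m) = fun m n => (-1 : ℂ) ^ N • (mulSub ^ N) f n m := by
  induction N generalizing f with
  | zero => funext m n; simp
  | succ N ih =>
    rw [pow_succ, Module.End.mul_apply,
      show mulSub (fun m n => f n m) = fun m n => ((-1 : ℂ) • mulSub f) n m from ?_, ih]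
    · funext m n
      rw [pow_succ (-1 : ℂ), Module.End.mul_apply, map_smul]
      simp only [Pi.smul_apply, smul_smul]
    · funext m n
      simp only [mulSub_apply, Pi.smul_apply, neg_smul, one_smul, neg_sub]

theorem IsLocal.symm {ε : ℂ} (hε : ε * ε = 1) {X Y : ℤ → Module.End ℂ V}
    (h : IsLocal ε X Y) : IsLocal ε Y X := by
  obtain ⟨N, hN⟩ := h
  refine ⟨N, ?_⟩
  have : scomm ε Y X = fun m n => ((-ε) • scomm ε X Y) n m := by
    funext m n
    simp only [scomm, Pi.smul_apply, smul_sub, smul_smul, neg_mul, hε, neg_smul, one_smul]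
    abel
  rw [this, mulSub_pow_swap, map_smul, hN]
  funext m n
  simp

theorem IsLocal.add_left {ε : ℂ} {X X' Y : ℤ → Module.End ℂ V} (h : IsLocal ε X Y)
    (h' : IsLocal ε X' Y) : IsLocal ε (X + X') Y := by
  obtain ⟨N, hN⟩ := h
  obtain ⟨N', hN'⟩ := h'
  refine ⟨max N N', ?_⟩
  have : scomm ε (X + X') Y = scomm ε X Y + scomm ε X' Y := by
    funext m n
    simp only [scomm, Pi.add_apply, add_mul, mul_add, smul_add]
    abel
  rw [this, map_add, mulSub_pow_mono (le_max_left _ _) hN,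
    mulSub_pow_mono (le_max_right _ _) hN', add_zero]

theorem IsLocal.smul_left {ε : ℂ} {X Y : ℤ → Module.End ℂ V} (c : ℂ) (h : IsLocal ε X Y) :
    IsLocal ε (c • X) Y := by
  obtain ⟨N, hN⟩ := h
  refine ⟨N, ?_⟩
  have : scomm ε (c • X) Y = c • scomm ε X Y := by
    funext m n
    simp only [scomm, Pi.smul_apply, smul_mul_assoc, mul_smul_comm, smul_sub, smul_comm c ε]
  rw [this, map_smul, hN, smul_zero]

/-- Coefficients of the derivative `∂_z X(z)`. -/
def deriv (X : ℤ → Module.End ℂ V) : ℤ → Module.End ℂ V := fun n => (-(n : ℂ)) • X (n - 1)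

theorem mulSub_pow_deriv {M : Type*} [AddCommGroup M] [Module ℂ M] (f : ℤ → ℤ → M) (N : ℕ) :
    (mulSub ^ (N + 1)) (fun (m n : ℤ) => (-(m : ℂ)) • f (m - 1) n) =
      (fun (m n : ℤ) => (-(m : ℂ)) • (mulSub ^ (N + 1)) f (m - 1) n) -
        ((N : ℂ) + 1) • (mulSub ^ N) f := by
  have h1 : ∀ g : ℤ → ℤ → M, mulSub (fun (m n : ℤ) => (-(m : ℂ)) • g (m - 1) n) =
      (fun (m n : ℤ) => (-(m : ℂ)) • mulSub g (m - 1) n) - g := by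
    intro g
    funext m n
    simp only [Pi.sub_apply, mulSub_apply, add_sub_cancel_right, sub_add_cancel]
    push_cast
    module
  induction N with
  | zero => simpa using h1 f
  | succ N ih =>
    rw [pow_succ', Module.End.mul_apply, ih, map_sub, h1, map_smul,
      ← Module.End.mul_apply, ← pow_succ', ← Module.End.mul_apply, ← pow_succ']
    push_cast
    module

theorem IsLocal.deriv_left {ε : ℂ} {X Y : ℤ → Module.End ℂ V} (h : IsLocal ε X Y) :
    IsLocal ε (deriv X) Y := by
  obtain ⟨N, hN⟩ := h
  refine ⟨N + 1, ?_⟩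
  have : scomm ε (deriv X) Y = fun (m n : ℤ) => (-(m : ℂ)) • scomm ε X Y (m - 1) n := by
    funext m n
    simp only [scomm, deriv, smul_mul_assoc, mul_smul_comm, smul_sub, smul_comm ε]
  funext m n
  rw [this, mulSub_pow_deriv, hN, mulSub_pow_mono (Nat.le_succ N) hN]
  simp

theorem eq_zero_of_mulSub_pow {M : Type*} [AddCommGroup M] [Module ℂ M] (N : ℕ)
    {f : ℤ → ℤ → M} (hf : (mulSub ^ N) f = 0) (K : ℤ) (hK : ∀ m n, K ≤ n → f m n = 0) :
    f = 0 := by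
  induction N generalizing f with
  | zero => simpa using hf
  | succ N ih =>
    rw [pow_succ, Module.End.mul_apply] at hf
    have h0 := ih hf (fun m n hn => by
      rw [mulSub_apply, hK _ _ hn, hK _ _ (by omega), sub_zero])
    have h1 : ∀ m n, f (m + 1) n = f m (n + 1) := fun m n =>
      sub_eq_zero.1 (congrFun (congrFun h0 m) n)
    have h2 : ∀ (k : ℕ) m n, f m n = f (m - k) (n + k) := by
      intro k
      induction k with
      | zero => simp
      | succ k ihk =>
        intro m n
        rw [ihk, ← sub_add_cancel (m - k) 1, h1]
        congr 1 <;> push_cast <;> ring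
    funext m n
    rw [h2 (K - n).toNat]
    exact hK _ _ (by omega)

/-! ### Three variables -/

/-- Multiplication by `x - z`, `x - w`, `z - w` on distributions in three indeterminates. -/
def mulXZ {M : Type*} [AddCommGroup M] [Module ℂ M] : Module.End ℂ (ℤ → ℤ → ℤ → M) where
  toFun f := fun m j n => f (m + 1) j n - f m (j + 1) n
  map_add' f g := by funext m j n; simp only [Pi.add_apply]; abel
  map_smul' c f := by funext m j n; simp only [Pi.smul_apply, RingHom.id_apply, smul_sub]

/-- See `mulXZ`. -/
def mulZW {M : Type*} [AddCommGroup M] [Module ℂ M] : Module.End ℂ (ℤ → ℤ → ℤ → M) where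
  toFun f := fun m j n => f m (j + 1) n - f m j (n + 1)
  map_add' f g := by funext m j n; simp only [Pi.add_apply]; abel
  map_smul' c f := by funext m j n; simp only [Pi.smul_apply, RingHom.id_apply, smul_sub]

/-- See `mulXZ`. -/
def mulXW {M : Type*} [AddCommGroup M] [Module ℂ M] : Module.End ℂ (ℤ → ℤ → ℤ → M) where
  toFun f := fun m j n => f (m + 1) j n - f m j (n + 1)
  map_add' f g := by funext m j n; simp only [Pi.add_apply]; abel
  map_smul' c f := by funext m j n; simp only [Pi.smul_apply, RingHom.id_apply, smul_sub]

section three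
variable {M M' : Type*} [AddCommGroup M] [Module ℂ M] [AddCommGroup M'] [Module ℂ M']

theorem mulXW_eq : (mulXW : Module.End ℂ (ℤ → ℤ → ℤ → M)) = mulXZ + mulZW := by
  ext f m j n
  simp [mulXW, mulXZ, mulZW]

theorem commute_xz_zw : Commute (mulXZ : Module.End ℂ (ℤ → ℤ → ℤ → M)) mulZW := by
  ext f m j n
  simp only [mulXZ, mulZW, Module.End.mul_apply, LinearMap.coe_mk, AddHom.coe_mk]
  abel

theorem commute_xw_xz : Commute (mulXW : Module.End ℂ (ℤ → ℤ → ℤ → M)) mulXZ := by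
  rw [mulXW_eq]
  exact (Commute.refl _).add_left commute_xz_zw.symm

theorem commute_xw_zw : Commute (mulXW : Module.End ℂ (ℤ → ℤ → ℤ → M)) mulZW := by
  rw [mulXW_eq]
  exact commute_xz_zw.add_left (Commute.refl _)

theorem mulXZ_pow (φ : ℤ → M →ₗ[ℂ] M') (N : ℕ) (f : ℤ → ℤ → M) :
    (mulXZ ^ N) (fun m j n => φ n (f m j)) = fun m j n => φ n ((mulSub ^ N) f m j) := by
  induction N generalizing f with
  | zero => rfl
  | succ N ih =>
    rw [pow_succ, pow_succ, Module.End.mul_apply, Module.End.mul_apply, ← ih]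
    congr 1
    funext m j n
    simp [mulSub_apply, mulXZ]

theorem mulXW_pow (φ : ℤ → M →ₗ[ℂ] M') (N : ℕ) (f : ℤ → ℤ → M) :
    (mulXW ^ N) (fun m j n => φ j (f m n)) = fun m j n => φ j ((mulSub ^ N) f m n) := by
  induction N generalizing f with
  | zero => rfl
  | succ N ih =>
    rw [pow_succ, pow_succ, Module.End.mul_apply, Module.End.mul_apply, ← ih]
    congr 1
    funext m j n
    simp [mulSub_apply, mulXW]

theorem mulZW_pow (φ : ℤ → M →ₗ[ℂ] M') (N : ℕ) (f : ℤ → ℤ → M) :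
    (mulZW ^ N) (fun m j n => φ m (f j n)) = fun m j n => φ m ((mulSub ^ N) f j n) := by
  induction N generalizing f with
  | zero => rfl
  | succ N ih =>
    rw [pow_succ, pow_succ, Module.End.mul_apply, Module.End.mul_apply, ← ih]
    congr 1
    funext m j n
    simp [mulSub_apply, mulZW]

theorem mulXZ_pow_nat (φ : M →ₗ[ℂ] M') (N : ℕ) (f : ℤ → ℤ → ℤ → M) :
    (mulXZ ^ N) (fun m j n => φ (f m j n)) = fun m j n => φ ((mulXZ ^ N) f m j n) := by
  induction N generalizing f with
  | zero => rfl
  | succ N ih =>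
    rw [pow_succ, pow_succ, Module.End.mul_apply, Module.End.mul_apply, ← ih]
    congr 1
    funext m j n
    simp [mulXZ]

theorem mulXW_pow_nat (φ : M →ₗ[ℂ] M') (N : ℕ) (f : ℤ → ℤ → ℤ → M) :
    (mulXW ^ N) (fun m j n => φ (f m j n)) = fun m j n => φ ((mulXW ^ N) f m j n) := by
  induction N generalizing f with
  | zero => rfl
  | succ N ih =>
    rw [pow_succ, pow_succ, Module.End.mul_apply, Module.End.mul_apply, ← ih]
    congr 1
    funext m j n
    simp [mulXW]

theorem mulZW_pow_nat (φ : M →ₗ[ℂ] M') (N : ℕ) (f : ℤ → ℤ → ℤ → M) :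
    (mulZW ^ N) (fun m j n => φ (f m j n)) = fun m j n => φ ((mulZW ^ N) f m j n) := by
  induction N generalizing f with
  | zero => rfl
  | succ N ih =>
    rw [pow_succ, pow_succ, Module.End.mul_apply, Module.End.mul_apply, ← ih]
    congr 1
    funext m j n
    simp [mulZW]

end three

end general

section general2

variable {V : Type*} [AddCommGroup V] [Module ℂ V]

set_option linter.unusedSectionVars false

/-- `X(z)` is a field: `X(z) v` has finitely many singular terms, for each `v`. -/
def IsField (X : ℤ → Module.End ℂ V) : Prop := ∀ v, ∃ N : ℤ, ∀ j, N ≤ j → X j v = 0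

theorem IsField.add {X Y : ℤ → Module.End ℂ V} (hX : IsField X) (hY : IsField Y) :
    IsField (X + Y) := by
  intro v
  obtain ⟨N, hN⟩ := hX v
  obtain ⟨N', hN'⟩ := hY v
  refine ⟨max N N', fun j hj => ?_⟩
  simp [hN j (le_trans (le_max_left _ _) hj), hN' j (le_trans (le_max_right _ _) hj)]

theorem IsField.smul {X : ℤ → Module.End ℂ V} (c : ℂ) (hX : IsField X) :
    IsField (c • X) := by
  intro v
  obtain ⟨N, hN⟩ := hX v
  exact ⟨N, fun j hj => by simp [hN j hj]⟩

theorem IsField.deriv {X : ℤ → Module.End ℂ V} (hX : IsField X) :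
    IsField (deriv X) := by
  intro v
  obtain ⟨N, hN⟩ := hX v
  exact ⟨N + 1, fun j hj => by simp [SUSYVA.deriv, hN (j - 1) (by omega)]⟩

/-- The summands of the coefficients of the normally ordered product. -/
def nopTerm (ε : ℂ) (A B : ℤ → Module.End ℂ V) (n j : ℤ) (v : V) : V :=
  if j < 0 then A j (B (n - 1 - j) v) else ε • B (n - 1 - j) (A j v)

theorem nopTerm_finite (ε : ℂ) {A B : ℤ → Module.End ℂ V} (hA : IsField A) (hB : IsField B)
    (n : ℤ) (v : V) : (fun j => nopTerm ε A B n j v).HasFiniteSupport := by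
  obtain ⟨N, hN⟩ := hA v
  obtain ⟨N', hN'⟩ := hB v
  refine (Set.finite_Icc (min 0 (n - 1 - N')) (max 0 N)).subset fun j hj => ?_
  by_contra h
  apply hj
  simp only [nopTerm]
  rw [Set.mem_Icc, not_and_or] at h
  split_ifs with h0
  · rw [hN' _ (by omega), map_zero]
  · rw [hN _ (by omega), map_zero, smul_zero]

/-- The normally ordered product `:A(z) B(z):`, with `ε` the sign of the exchange of `A` and `B`. -/
noncomputable def nop (ε : ℂ) (A B : ℤ → Module.End ℂ V) (hA : IsField A) (hB : IsField B) :
    ℤ → Module.End ℂ V := fun n =>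
  { toFun := fun v => ∑ᶠ j : ℤ, nopTerm ε A B n j v
    map_add' := fun v w => by
      rw [← finsum_add_distrib (nopTerm_finite ε hA hB n v) (nopTerm_finite ε hA hB n w)]
      congr 1
      funext j
      simp only [nopTerm]
      split_ifs <;> simp
    map_smul' := fun c v => by
      rw [RingHom.id_apply, smul_finsum' c (nopTerm_finite ε hA hB n v)]
      congr 1
      funext j
      simp only [nopTerm]
      split_ifs <;> simp [smul_comm c ε] }

theorem nop_apply (ε : ℂ) {A B : ℤ → Module.End ℂ V} (hA : IsField A) (hB : IsField B)
    (n : ℤ) (v : V) : nop ε A B hA hB n v = ∑ᶠ j : ℤ, nopTerm ε A B n j v := rfl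

theorem IsField.nop {ε : ℂ} {A B : ℤ → Module.End ℂ V} (hA : IsField A) (hB : IsField B) :
    IsField (nop ε A B hA hB) := by
  intro v
  obtain ⟨N, hN⟩ := hA v
  obtain ⟨N', hN'⟩ := hB v
  choose K hK using fun j : ℤ => hB (A j v)
  obtain ⟨K', hK'⟩ := ((Finset.Icc 0 N).image fun j => K j + j + 1).exists_le
  refine ⟨max N' K', fun n hn => ?_⟩
  rw [nop_apply]
  refine finsum_eq_zero_of_forall_eq_zero fun j => ?_
  simp only [nopTerm]
  split_ifs with h0
  · rw [hN' _ (by omega), map_zero]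
  · by_cases hj : N ≤ j
    · rw [hN _ hj, map_zero, smul_zero]
    · have := hK' (K j + j + 1) (Finset.mem_image_of_mem _ (Finset.mem_Icc.2 (by omega)))
      rw [hK j _ (by omega), smul_zero]

/-- Auxiliary: the summation defining a normally ordered product. -/
noncomputable def nsum (y : ℤ → ℤ → ℤ → V × V) (m n : ℤ) : V :=
  ∑ᶠ j : ℤ, if j < 0 then (y m j (n - 1 - j)).1 else (y m j (n - 1 - j)).2

/-- Auxiliary: the finiteness needed for `nsum`. -/
def NFin (y : ℤ → ℤ → ℤ → V × V) : Prop :=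
  ∀ m n, ∃ R : ℤ, ∀ j, (j ≤ -R → (y m j (n - j)).1 = 0) ∧ (R ≤ j → (y m j (n - j)).2 = 0)

theorem NFin.fin {y : ℤ → ℤ → ℤ → V × V} (h : NFin y) (m n : ℤ) :
    (fun j : ℤ => if j < 0 then (y m j (n - 1 - j)).1
      else (y m j (n - 1 - j)).2).HasFiniteSupport := by
  obtain ⟨R, hR⟩ := h m (n - 1)
  refine (Set.finite_Icc (min 0 (-R)) (max 0 R)).subset fun j hj => ?_
  by_contra hc
  apply hj
  rw [Set.mem_Icc, not_and_or] at hc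
  dsimp only
  split_ifs with h0
  · exact (hR j).1 (by omega)
  · exact (hR j).2 (by omega)

theorem NFin.xw {y : ℤ → ℤ → ℤ → V × V} (h : NFin y) : NFin (mulXW y) := by
  intro m n
  obtain ⟨R, hR⟩ := h (m + 1) n
  obtain ⟨R', hR'⟩ := h m (n + 1)
  refine ⟨max R R', fun j => ⟨fun hj => ?_, fun hj => ?_⟩⟩
  · have h1 := (hR j).1 (by omega)
    have h2 := (hR' j).1 (by omega)
    simp only [mulXW, LinearMap.coe_mk, AddHom.coe_mk, Prod.fst_sub, h1,
      show n - j + 1 = n + 1 - j by ring, h2, sub_zero]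
  · have h1 := (hR j).2 (by omega)
    have h2 := (hR' j).2 (by omega)
    simp only [mulXW, LinearMap.coe_mk, AddHom.coe_mk, Prod.snd_sub, h1,
      show n - j + 1 = n + 1 - j by ring, h2, sub_zero]

theorem NFin.xz {y : ℤ → ℤ → ℤ → V × V} (h : NFin y) : NFin (mulXZ y) := by
  intro m n
  obtain ⟨R, hR⟩ := h (m + 1) n
  obtain ⟨R', hR'⟩ := h m (n + 1)
  refine ⟨max R (R' + 1), fun j => ⟨fun hj => ?_, fun hj => ?_⟩⟩
  · have h1 := (hR j).1 (by omega)
    have h2 := (hR' (j + 1)).1 (by omega)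
    simp only [mulXZ, LinearMap.coe_mk, AddHom.coe_mk, Prod.fst_sub,
      show n - j = n + 1 - (j + 1) by ring, h2, sub_zero]
    simpa using h1
  · have h1 := (hR j).2 (by omega)
    have h2 := (hR' (j + 1)).2 (by omega)
    simp only [mulXZ, LinearMap.coe_mk, AddHom.coe_mk, Prod.snd_sub,
      show n - j = n + 1 - (j + 1) by ring, h2, sub_zero]
    simpa using h1

theorem NFin.sub {y y' : ℤ → ℤ → ℤ → V × V} (h : NFin y) (h' : NFin y') : NFin (y - y') := by
  intro m n
  obtain ⟨R, hR⟩ := h m n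
  obtain ⟨R', hR'⟩ := h' m n
  refine ⟨max R R', fun j => ⟨fun hj => ?_, fun hj => ?_⟩⟩
  · simp [(hR j).1 (by omega), (hR' j).1 (by omega)]
  · simp [(hR j).2 (by omega), (hR' j).2 (by omega)]

theorem NFin.zw {y : ℤ → ℤ → ℤ → V × V} (h : NFin y) : NFin (mulZW y) := by
  have : mulZW y = mulXW y - mulXZ y := by
    rw [mulXW_eq]; simp
  rw [this]
  exact h.xw.sub h.xz

theorem nsum_sub {y y' : ℤ → ℤ → ℤ → V × V} (h : NFin y) (h' : NFin y') :
    nsum (y - y') = nsum y - nsum y' := by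
  funext m n
  simp only [nsum, Pi.sub_apply]
  rw [← finsum_sub_distrib (h.fin m n) (h'.fin m n)]
  congr 1
  funext j
  split_ifs <;> simp

theorem nsum_add {y y' : ℤ → ℤ → ℤ → V × V} (h : NFin y) (h' : NFin y') :
    nsum (y + y') = nsum y + nsum y' := by
  funext m n
  simp only [nsum, Pi.add_apply]
  rw [← finsum_add_distrib (h.fin m n) (h'.fin m n)]
  congr 1
  funext j
  split_ifs <;> simp

theorem nsum_xw {y : ℤ → ℤ → ℤ → V × V} (h : NFin y) : nsum (mulXW y) = mulSub (nsum y) := by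
  funext m n
  simp only [nsum, mulSub_apply]
  rw [← finsum_sub_distrib (h.fin (m + 1) n) (h.fin m (n + 1))]
  congr 1
  funext j
  simp only [mulXW, LinearMap.coe_mk, AddHom.coe_mk,
    show n - 1 - j + 1 = n + 1 - 1 - j by ring]
  split_ifs <;> simp

theorem nsum_zw {y : ℤ → ℤ → ℤ → V × V} (h : NFin y) :
    nsum (mulZW y) = fun m n => (y m 0 n).1 - (y m 0 n).2 := by
  funext m n
  have e1 : nsum (mulZW y) m n = ∑ᶠ j : ℤ,
      ((if j + 1 < 1 then (y m (j + 1) (n + 1 - 1 - (j + 1))).1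
        else (y m (j + 1) (n + 1 - 1 - (j + 1))).2) -
      (if j < 0 then (y m j (n + 1 - 1 - j)).1 else (y m j (n + 1 - 1 - j)).2)) := by
    simp only [nsum]
    congr 1
    funext j
    simp only [mulZW, LinearMap.coe_mk, AddHom.coe_mk,
      show n - 1 - j + 1 = n + 1 - 1 - j by ring, show n + 1 - 1 - (j + 1) = n - 1 - j by ring]
    by_cases hj : j < 0
    · rw [if_pos hj, if_pos (by omega), if_pos hj, Prod.fst_sub]
    · rw [if_neg hj, if_neg (by omega), if_neg hj, Prod.snd_sub]
  have hf2 := h.fin m (n + 1)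
  have hf1 : (fun j : ℤ => if j < 1 then (y m j (n + 1 - 1 - j)).1
      else (y m j (n + 1 - 1 - j)).2).HasFiniteSupport := by
    refine (hf2.union (Set.finite_singleton 0)).subset fun j hj => ?_
    by_cases h0 : j = 0
    · exact Or.inr h0
    · left
      rw [Function.mem_support] at hj ⊢
      by_cases h1 : j < 0
      · rwa [if_pos (by omega)] at hj ⊢
      · rwa [if_neg (by omega)] at hj ⊢
  have hf1' := hf1.comp_of_injective (add_left_injective (1 : ℤ))
  rw [Function.comp_def] at hf1'
  rw [e1]
  have e2 := finsum_comp_equiv (Equiv.addRight (1 : ℤ)) (f := fun j : ℤ =>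
    if j < 1 then (y m j (n + 1 - 1 - j)).1 else (y m j (n + 1 - 1 - j)).2)
  simp only [Equiv.coe_addRight] at e2
  rw [finsum_sub_distrib hf1' hf2]
  refine (congrArg₂ (· - ·) e2 rfl).trans ?_
  rw [← finsum_sub_distrib hf1 hf2, finsum_eq_single _ 0]
  · simp
  · intro j hj
    by_cases h1 : j < 0
    · rw [if_pos (by omega), if_pos h1, sub_self]
    · rw [if_neg (by omega), if_neg h1, sub_self]

theorem NFin.pow {y : ℤ → ℤ → ℤ → V × V} (h : NFin y) (i j k : ℕ) :
    NFin ((mulXW ^ k) ((mulXZ ^ i) ((mulZW ^ j) y))) := by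
  have h1 : NFin ((mulZW ^ j) y) := by
    induction j with
    | zero => exact h
    | succ j ih => rw [pow_succ', Module.End.mul_apply]; exact ih.zw
  have h2 : NFin ((mulXZ ^ i) ((mulZW ^ j) y)) := by
    induction i with
    | zero => exact h1
    | succ i ih => rw [pow_succ', Module.End.mul_apply]; exact ih.xz
  induction k with
  | zero => exact h2
  | succ k ih => rw [pow_succ', Module.End.mul_apply]; exact ih.xw

theorem nsum_xw_pow {y : ℤ → ℤ → ℤ → V × V} (h : NFin y) (k : ℕ) :
    nsum ((mulXW ^ k) y) = (mulSub ^ k) (nsum y) := by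
  induction k with
  | zero => rfl
  | succ k ih =>
    rw [pow_succ', pow_succ', Module.End.mul_apply, Module.End.mul_apply,
      nsum_xw (by simpa using h.pow 0 0 k), ih]

theorem nsum_zero : nsum (0 : ℤ → ℤ → ℤ → V × V) = 0 := by
  funext m n
  simp [nsum]

/-- The combinatorial core of Dong's lemma. -/
theorem nsum_kill {y : ℤ → ℤ → ℤ → V × V} (h : NFin y) {K L N : ℕ}
    (h1 : (mulXZ ^ K) ((mulXW ^ L) y) = 0)
    (h2 : (mulZW ^ N) (fun m j n => (y m j n).1 - (y m j n).2) = 0) :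
    (mulSub ^ (K + N + 1 + L)) (nsum y) = 0 := by
  have hcomm : ∀ (M i j : ℕ), K + N + 1 ≤ i + j + M →
      nsum ((mulXW ^ M) ((mulXZ ^ i) ((mulZW ^ j) ((mulXW ^ L) y)))) = 0 := by
    have hy' : NFin ((mulXW ^ L) y) := by simpa using h.pow 0 0 L
    intro M
    induction M with
    | zero =>
      intro i j hij
      rw [pow_zero, Module.End.one_apply]
      by_cases hi : K ≤ i
      · obtain ⟨k, rfl⟩ := Nat.exists_eq_add_of_le hi
        rw [← Module.End.mul_apply, (commute_xz_zw.pow_pow _ _).eq, Module.End.mul_apply,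
          add_comm K k, pow_add, Module.End.mul_apply, h1, map_zero, map_zero, nsum_zero]
      · obtain ⟨k, rfl⟩ := Nat.exists_eq_add_of_le (show N + 1 ≤ j by omega)
        have e : (mulXZ ^ i) ((mulZW ^ (N + 1 + k)) ((mulXW ^ L) y)) =
            mulZW ((mulXW ^ L) ((mulXZ ^ i) ((mulZW ^ k) ((mulZW ^ N) y)))) := by
          simp only [← Module.End.mul_apply]
          congr 1
          have c1 := (commute_xz_zw (M := V × V)).pow_pow i 1
          have c2 := (commute_xw_zw (M := V × V)).pow_pow L (k + N)
          have c3 := (commute_xw_xz (M := V × V)).pow_pow L i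
          rw [pow_one] at c1
          rw [show N + 1 + k = 1 + (k + N) by omega, pow_add, pow_one]
          calc mulXZ ^ i * (mulZW * mulZW ^ (k + N) * mulXW ^ L)
              = mulXZ ^ i * mulZW * (mulZW ^ (k + N) * mulXW ^ L) := by simp only [mul_assoc]
            _ = mulZW * mulXZ ^ i * (mulXW ^ L * mulZW ^ (k + N)) := by rw [c1.eq, c2.eq]
            _ = mulZW * (mulXZ ^ i * mulXW ^ L) * mulZW ^ (k + N) := by simp only [mul_assoc]
            _ = mulZW * (mulXW ^ L * mulXZ ^ i) * mulZW ^ (k + N) := by rw [c3.eq]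
            _ = _ := by rw [pow_add]; simp only [mul_assoc]
        rw [e, nsum_zw]
        · let δ : (V × V) →ₗ[ℂ] V := LinearMap.fst ℂ V V - LinearMap.snd ℂ V V
          have e3 := mulXW_pow_nat δ L ((mulXZ ^ i) ((mulZW ^ k) ((mulZW ^ N) y)))
          rw [← mulXZ_pow_nat, ← mulZW_pow_nat, ← mulZW_pow_nat,
            show (fun m j n => δ (y m j n)) = fun m j n => (y m j n).1 - (y m j n).2 from rfl,
            h2, map_zero, map_zero, map_zero] at e3
          funext m n
          exact (congrFun (congrFun (congrFun e3 m) 0) n).symm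
        · simp only [← Module.End.mul_apply]
          simpa only [← Module.End.mul_apply, mul_assoc, ← pow_add] using h.pow i (k + N) L
    | succ M ih =>
      intro i j hij
      have c1 := (commute_xz_zw (M := V × V)).pow_pow i 1
      rw [pow_one] at c1
      have e4 : mulXW ((mulXZ ^ i) ((mulZW ^ j) ((mulXW ^ L) y))) =
          (mulXZ ^ (i + 1)) ((mulZW ^ j) ((mulXW ^ L) y)) +
            (mulXZ ^ i) ((mulZW ^ (j + 1)) ((mulXW ^ L) y)) := by
        rw [mulXW_eq, LinearMap.add_apply, ← mulXW_eq, pow_succ' _ i, pow_succ' _ j,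
          Module.End.mul_apply, Module.End.mul_apply, ← Module.End.mul_apply mulZW, ← c1.eq,
          Module.End.mul_apply]
      rw [pow_succ, Module.End.mul_apply, e4, map_add, nsum_add (hy'.pow _ _ _) (hy'.pow _ _ _),
        ih _ _ (by omega), ih _ _ (by omega), add_zero]
  rw [pow_add, Module.End.mul_apply, ← nsum_xw_pow h, ← nsum_xw_pow (by simpa using h.pow 0 0 L)]
  simpa using hcomm (K + N + 1) 0 0 (by omega)

end general2

section general3

variable {V : Type*} [AddCommGroup V] [Module ℂ V]

/-- Dong's lemma for normally ordered products. -/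
theorem IsLocal.nop_right {ε₁ ε₂ ε₃ : ℂ} {A B C : ℤ → Module.End ℂ V} (hA : IsField A)
    (hB : IsField B) (h₁ : IsLocal ε₁ C A) (h₂ : IsLocal ε₂ C B)
    (h₃ : IsLocal ε₃ A B) : IsLocal (ε₁ * ε₂) C (nop ε₃ A B hA hB) := by
  obtain ⟨K, hK⟩ := h₁
  obtain ⟨L, hL⟩ := h₂
  obtain ⟨N, hN⟩ := h₃
  refine ⟨K + N + 1 + L, ?_⟩
  funext m n
  refine LinearMap.ext fun v => ?_
  let y : ℤ → ℤ → ℤ → V × V := fun m j k =>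
    (C m (A j (B k v)) - (ε₁ * ε₂) • A j (B k (C m v)),
      ε₃ • (C m (B k (A j v)) - (ε₁ * ε₂) • B k (A j (C m v))))
  have hy : NFin y := by
    intro m n
    obtain ⟨R1, h1⟩ := hB v
    obtain ⟨R2, h2⟩ := hB (C m v)
    obtain ⟨R3, h3⟩ := hA v
    obtain ⟨R4, h4⟩ := hA (C m v)
    refine ⟨max (max (R1 - n) (R2 - n)) (max R3 R4), fun j => ⟨fun hj => ?_, fun hj => ?_⟩⟩
    · simp only [y]
      rw [h1 _ (by omega), h2 _ (by omega)]
      simp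
    · simp only [y]
      rw [h3 _ (by omega), h4 _ (by omega)]
      simp
  have hs : (fun m n => scomm (ε₁ * ε₂) C (nop ε₃ A B hA hB) m n v) = nsum y := by
    funext m n
    simp only [scomm, LinearMap.sub_apply, LinearMap.smul_apply, Module.End.mul_apply,
      nop_apply, nsum]
    have e1 := (C m).toAddMonoidHom.map_finsum (nopTerm_finite ε₃ hA hB n v)
    have f1 : (fun j => C m (nopTerm ε₃ A B n j v)).HasFiniteSupport :=
      (nopTerm_finite ε₃ hA hB n v).subset fun j hj hc => hj (by simp [hc])
    have f2 : (fun j => (ε₁ * ε₂) • nopTerm ε₃ A B n j (C m v)).HasFiniteSupport :=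
      (nopTerm_finite ε₃ hA hB n (C m v)).subset fun j hj hc => hj (by simp [hc])
    simp only [LinearMap.toAddMonoidHom_coe] at e1
    rw [e1, smul_finsum' _ (nopTerm_finite ε₃ hA hB n (C m v)), ← finsum_sub_distrib f1 f2]
    congr 1
    funext j
    simp only [nopTerm, y]
    split_ifs
    · rfl
    · rw [map_smul, smul_sub, smul_comm ε₃]
  have hx := mulSub_pow_map (LinearMap.applyₗ v : Module.End ℂ V →ₗ[ℂ] V) (K + N + 1 + L)
    (scomm (ε₁ * ε₂) C (nop ε₃ A B hA hB))
  simp only [LinearMap.applyₗ_apply_apply] at hx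
  rw [hs, nsum_kill hy (K := K) (L := L) (N := N)] at hx
  · exact (congrFun (congrFun hx m) n).symm
  · -- the product of the three fields
    have a1 := mulXZ_pow (fun k => (LinearMap.applyₗ (B k v) : Module.End ℂ V →ₗ[ℂ] V)) K
      (scomm ε₁ C A)
    have a2 := mulXW_pow (fun j => ((A j) ∘ₗ (LinearMap.applyₗ v : Module.End ℂ V →ₗ[ℂ] V) :
      Module.End ℂ V →ₗ[ℂ] V)) L (scomm ε₂ C B)
    have a3 := mulXW_pow (fun j => (LinearMap.applyₗ (A j v) : Module.End ℂ V →ₗ[ℂ] V)) L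
      (scomm ε₂ C B)
    have a4 := mulXZ_pow (fun k => ((B k) ∘ₗ (LinearMap.applyₗ v : Module.End ℂ V →ₗ[ℂ] V) :
      Module.End ℂ V →ₗ[ℂ] V)) K (scomm ε₁ C A)
    rw [hK] at a1 a4
    rw [hL] at a2 a3
    let p1 : ℤ → ℤ → ℤ → V := fun m j n =>
      (LinearMap.applyₗ (B n v) : Module.End ℂ V →ₗ[ℂ] V) (scomm ε₁ C A m j)
    let p2 : ℤ → ℤ → ℤ → V := fun m j n =>
      ((A j) ∘ₗ (LinearMap.applyₗ v : Module.End ℂ V →ₗ[ℂ] V)) (scomm ε₂ C B m n)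
    let p3 : ℤ → ℤ → ℤ → V := fun m j n =>
      (LinearMap.applyₗ (A j v) : Module.End ℂ V →ₗ[ℂ] V) (scomm ε₂ C B m n)
    let p4 : ℤ → ℤ → ℤ → V := fun m j n =>
      ((B n) ∘ₗ (LinearMap.applyₗ v : Module.End ℂ V →ₗ[ℂ] V)) (scomm ε₁ C A m j)
    have b1 : (mulXZ ^ K) p1 = 0 := by rw [a1]; funext m j n; simp
    have b2 : (mulXW ^ L) p2 = 0 := by rw [a2]; funext m j n; simp
    have b3 : (mulXW ^ L) p3 = 0 := by rw [a3]; funext m j n; simp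
    have b4 : (mulXZ ^ K) p4 = 0 := by rw [a4]; funext m j n; simp
    have hc : ∀ p : ℤ → ℤ → ℤ → V, (mulXZ ^ K) ((mulXW ^ L) p) =
        (mulXW ^ L) ((mulXZ ^ K) p) := fun p => by
      rw [← Module.End.mul_apply, ← Module.End.mul_apply, (commute_xw_xz.pow_pow L K).eq]
    have c1 : (fun m j n => LinearMap.fst ℂ V V (y m j n)) = p1 + ε₁ • p2 := by
      funext m j n
      simp only [y, p1, p2, scomm, LinearMap.fst_apply, Pi.add_apply, Pi.smul_apply,
        LinearMap.applyₗ_apply_apply, LinearMap.comp_apply,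
        Module.End.mul_apply, map_sub, map_smul, smul_sub, smul_smul]
      abel
    have c2 : (fun m j n => LinearMap.snd ℂ V V (y m j n)) =
        ε₃ • p3 + (ε₃ * ε₂) • p4 := by
      funext m j n
      simp only [y, p3, p4, scomm, LinearMap.snd_apply, Pi.add_apply, Pi.smul_apply,
        LinearMap.applyₗ_apply_apply, LinearMap.comp_apply,
        Module.End.mul_apply, map_sub, map_smul, smul_sub, smul_smul]
      module
    have d1 : (mulXZ ^ K) ((mulXW ^ L) (p1 + ε₁ • p2)) = 0 := by
      rw [map_add, map_add, map_smul, b2, hc, b1]; simp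
    have d2 : (mulXZ ^ K) ((mulXW ^ L) (ε₃ • p3 + (ε₃ * ε₂) • p4)) = 0 := by
      rw [map_add, map_add, map_smul, map_smul, b3, map_smul, map_smul, hc, b4]; simp
    rw [← c1, mulXW_pow_nat, mulXZ_pow_nat] at d1
    rw [← c2, mulXW_pow_nat, mulXZ_pow_nat] at d2
    funext m j n
    exact Prod.ext (congrFun (congrFun (congrFun d1 m) j) n)
      (congrFun (congrFun (congrFun d2 m) j) n)
  · have a1 := mulZW_pow (fun m => ((C m) ∘ₗ (LinearMap.applyₗ v : Module.End ℂ V →ₗ[ℂ] V) :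
      Module.End ℂ V →ₗ[ℂ] V)) N (scomm ε₃ A B)
    have a2 := mulZW_pow (fun m => (LinearMap.applyₗ (C m v) : Module.End ℂ V →ₗ[ℂ] V)) N
      (scomm ε₃ A B)
    rw [hN] at a1 a2
    have e : (fun m j n => (y m j n).1 - (y m j n).2) =
        (fun m j n => ((C m) ∘ₗ (LinearMap.applyₗ v : Module.End ℂ V →ₗ[ℂ] V))
          (scomm ε₃ A B j n)) -
        (ε₁ * ε₂) • (fun m j n => (LinearMap.applyₗ (C m v) : Module.End ℂ V →ₗ[ℂ] V)
          (scomm ε₃ A B j n)) := by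
      funext m j n
      simp only [y, scomm, Pi.sub_apply, Pi.smul_apply,
        LinearMap.applyₗ_apply_apply, LinearMap.comp_apply,
        Module.End.mul_apply, map_sub, map_smul, smul_sub, smul_smul]
      module
    rw [e, map_sub, map_smul, a1, a2]
    funext m j n
    simp

/-- Goddard's uniqueness, in the form of one step: if `X` is local with `Y` and annihilates `v`,
and `Y` is a field, then `X` annihilates `Y v`. -/
theorem IsLocal.apply_eq_zero {ε : ℂ} {X Y : ℤ → Module.End ℂ V} (h : IsLocal ε X Y)
    (hY : IsField Y) {v : V} (hv : ∀ m, X m v = 0) (m n : ℤ) : X m (Y n v) = 0 := by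
  obtain ⟨N, hN⟩ := h
  obtain ⟨K, hK⟩ := hY v
  have hx := mulSub_pow_map (LinearMap.applyₗ v : Module.End ℂ V →ₗ[ℂ] V) N (scomm ε X Y)
  rw [hN] at hx
  have := eq_zero_of_mulSub_pow N (f := fun m n => X m (Y n v)) ?_ K ?_
  · exact congrFun (congrFun this m) n
  · rw [show (fun m n => X m (Y n v)) = fun m n =>
      (LinearMap.applyₗ v : Module.End ℂ V →ₗ[ℂ] V) (scomm ε X Y m n) from ?_, hx]
    · funext m n; simp
    · funext m n
      simp [scomm, hv]
  · intro m n hn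
    rw [hK n hn, map_zero]

/-- `[T, X(z)] = ∂_z X(z)`. -/
def IsCov (T : Module.End ℂ V) (X : ℤ → Module.End ℂ V) : Prop :=
  ∀ n v, T (X n v) - X n (T v) = (-(n : ℂ)) • X (n - 1) v

theorem IsCov.nop {T : Module.End ℂ V} {ε : ℂ} {A B : ℤ → Module.End ℂ V} (hA : IsField A)
    (hB : IsField B) (tA : IsCov T A) (tB : IsCov T B) : IsCov T (nop ε A B hA hB) := by
  intro n v
  have tA' : ∀ n v, T (A n v) = A n (T v) + (-(n : ℂ)) • A (n - 1) v := fun n v => by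
    rw [← tA, add_sub_cancel]
  have tB' : ∀ n v, T (B n v) = B n (T v) + (-(n : ℂ)) • B (n - 1) v := fun n v => by
    rw [← tB, add_sub_cancel]
  simp only [nop_apply]
  have e1 := T.toAddMonoidHom.map_finsum (nopTerm_finite ε hA hB n v)
  simp only [LinearMap.toAddMonoidHom_coe] at e1
  have f1 : (fun j => T (nopTerm ε A B n j v)).HasFiniteSupport :=
    (nopTerm_finite ε hA hB n v).subset fun j hj hc => hj (by simp [hc])
  have f2 := nopTerm_finite ε hA hB n (T v)
  have f3 := nopTerm_finite ε hA hB (n - 1) v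
  have f4 : (fun j : ℤ => (j : ℂ) • nopTerm ε A B (n - 1) (j - 1) v).HasFiniteSupport := by
    have := f3.comp_of_injective (sub_left_injective (b := (1 : ℤ)))
    exact this.subset fun j hj hc => hj (by simp [Function.comp] at hc; simp [hc])
  have f5 : (fun j : ℤ => ((j : ℂ) - n + 1) • nopTerm ε A B (n - 1) j v).HasFiniteSupport :=
    f3.subset fun j hj hc => hj (by simp [hc])
  rw [e1, ← finsum_sub_distrib f1 f2]
  have e2 : ∀ j, T (nopTerm ε A B n j v) - nopTerm ε A B n j (T v) =
      ((j : ℂ) - n + 1) • nopTerm ε A B (n - 1) j v -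
        (j : ℂ) • nopTerm ε A B (n - 1) (j - 1) v := by
    intro j
    simp only [nopTerm]
    rcases lt_trichotomy j 0 with hj | rfl | hj
    · rw [if_pos hj, if_pos hj, if_pos hj, if_pos (by omega), tA', tB',
        show n - 1 - 1 - (j - 1) = n - 1 - j by ring, show n - 1 - 1 - j = n - 1 - j - 1 by ring,
        map_add, map_smul]
      push_cast
      module
    · simp only [lt_irrefl, if_false, map_smul, tA', tB']
      simp only [Int.cast_zero, zero_smul, neg_zero, add_zero, sub_zero,
        show n - 1 - 1 = n - 2 by ring]
      push_cast
      module
    · rw [if_neg (by omega), if_neg (by omega), if_neg (by omega), if_neg (by omega), map_smul,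
        tB', tA',
        show n - 1 - 1 - (j - 1) = n - 1 - j by ring, show n - 1 - 1 - j = n - 1 - j - 1 by ring,
        map_add, map_smul]
      push_cast
      module
  have e3 := finsum_comp_equiv (Equiv.addRight (1 : ℤ))
    (f := fun j : ℤ => (j : ℂ) • nopTerm ε A B (n - 1) (j - 1) v)
  have f6 : (fun j : ℤ => ((j : ℂ) + 1) • nopTerm ε A B (n - 1) j v).HasFiniteSupport :=
    f3.subset fun j hj hc => hj (by simp [hc])
  rw [finsum_congr e2, finsum_sub_distrib f5 f4, ← e3]
  simp only [Equiv.coe_addRight, add_sub_cancel_right, Int.cast_add, Int.cast_one]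
  rw [← finsum_sub_distrib f5 f6, smul_finsum' _ f3]
  congr 1
  funext j
  module

end general3

/-- An `N_K = 1` SUSY vertex algebra structure on `V`. The state-field correspondence
`Y(a, z, θ) = ∑ z^(-j-1) a_(j|1) + θ ∑ z^(-j-1) a_(j|0)` is given by its coefficients
`mode a j i = a_(j|i)`. -/
structure SUSYVertexAlgebra (V : Type*) [AddCommGroup V] [Module ℂ V] where
  /-- the even part `gr 0` and the odd part `gr 1` -/
  gr : ZMod 2 → Submodule ℂ V
  gr_internal : DirectSum.IsInternal gr
  /-- the vacuum vector -/
  vac : V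
  vac_mem : vac ∈ gr 0
  /-- the odd endomorphism `D` -/
  D : Module.End ℂ V
  D_mem : ∀ p, ∀ v ∈ gr p, D v ∈ gr (p + 1)
  /-- the operators `a_(j|i)` -/
  mode : V →ₗ[ℂ] ℤ → ZMod 2 → Module.End ℂ V
  /-- `Y` preserves parity, where `θ` is odd -/
  mode_mem : ∀ p q, ∀ a ∈ gr p, ∀ v ∈ gr q, ∀ j i, mode a j i v ∈ gr (p + q + i + 1)
  /-- `Y(a, z, θ)` is a superfield -/
  mode_field : ∀ a v, ∃ N : ℤ, ∀ j, N ≤ j → ∀ i, mode a j i v = 0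
  D_vac : D vac = 0
  /-- `Y(a, z, θ)|0⟩` is regular at `z = 0` -/
  mode_vac : ∀ a j, 0 ≤ j → ∀ i, mode a j i vac = 0
  /-- `Y(a, z, θ)|0⟩ = a` at `z = 0`, `θ = 0` -/
  mode_neg_one_vac : ∀ a, mode a (-1) 1 vac = a
  /-- `[D, Y(a, z, θ)] = (∂_θ - θ ∂_z) Y(a, z, θ)`, constant coefficient in `θ` -/
  D_mode_one : ∀ p, ∀ a ∈ gr p, ∀ j,
    D * mode a j 1 - sgn p • (mode a j 1 * D) = mode a j 0
  /-- `[D, Y(a, z, θ)] = (∂_θ - θ ∂_z) Y(a, z, θ)`, coefficient of `θ`; the sign on the left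
  comes from `D θ = - θ D` -/
  D_mode_zero : ∀ p, ∀ a ∈ gr p, ∀ j,
    -(D * mode a j 0 - sgn (p + 1) • (mode a j 0 * D)) = -((-(j : ℂ)) • mode a (j - 1) 1)
  /-- `(z - w)^n [Y(a, z, θ), Y(b, w, ζ)] = 0` for some `n`; the coefficient `a_(j|i)` has parity
  `p + i + 1` -/
  locality : ∀ p q, ∀ a ∈ gr p, ∀ b ∈ gr q, ∃ N : ℕ, ∀ i k,
    (mulSub ^ N) (fun m n => mode a m i * mode b n k -
      sgn ((p + i + 1) * (q + k + 1)) • (mode b n k * mode a m i)) = 0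

/-- Data for the reconstruction of a SUSY vertex algebra from generating superfields
`x g` of parity `par g`, with components `x g 1` and `x g 0`; `P` is the parity involution. -/
structure GenSystem (V : Type*) [AddCommGroup V] [Module ℂ V] (G : Type*) where
  vac : V
  D : Module.End ℂ V
  P : Module.End ℂ V
  par : G → ZMod 2
  x : G → ZMod 2 → ℤ → Module.End ℂ V
  P_P : ∀ v, P (P v) = v
  P_vac : P vac = vac
  P_D : ∀ v, P (D v) = - D (P v)
  P_x : ∀ g i m v, P (x g i m v) = sgn (par g + i + 1) • x g i m (P v)
  D_vac : D vac = 0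
  x_vac : ∀ g i m, 0 ≤ m → x g i m vac = 0
  D_x_one : ∀ g m, D * x g 1 m - sgn (par g) • (x g 1 m * D) = x g 0 m
  D_x_zero : ∀ g m, D * x g 0 m - sgn (par g + 1) • (x g 0 m * D) = (-(m : ℂ)) • x g 1 (m - 1)
  x_field : ∀ g i, IsField (x g i)
  x_local : ∀ g h i k, IsLocal (sgn ((par g + i + 1) * (par h + k + 1))) (x g i) (x h k)
  generates : ∀ N : Submodule ℂ V, vac ∈ N →
    (∀ g i m, m < 0 → ∀ v ∈ N, x g i m v ∈ N) → ∀ v, v ∈ N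

/-- The coefficients of the identity field. -/
def idField {V : Type*} [AddCommGroup V] [Module ℂ V] : ℤ → Module.End ℂ V :=
  fun n => if n = -1 then 1 else 0

/-- The supercommutator of `D` and a field of parity `p`. -/
def adD {V : Type*} [AddCommGroup V] [Module ℂ V] (D : Module.End ℂ V) (p : ZMod 2)
    (X : ℤ → Module.End ℂ V) : ℤ → Module.End ℂ V := fun n => D * X n - sgn p • (X n * D)

namespace GenSystem

variable {V : Type*} [AddCommGroup V] [Module ℂ V] {G : Type*} (S : GenSystem V G)

/-- The fields of parity `p` generated from the components of the generating superfields. -/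
inductive Fld : ZMod 2 → (ℤ → Module.End ℂ V) → Prop
  | zero (p) : Fld p 0
  | add {p X Y} : Fld p X → Fld p Y → Fld p (X + Y)
  | smul {p X} (c : ℂ) : Fld p X → Fld p (c • X)
  | one : Fld 0 idField
  | gen (g i) : Fld (S.par g + i + 1) (S.x g i)
  | deriv {p X} : Fld p X → Fld p (deriv X)
  | adD {p X} : Fld p X → Fld (p + 1) (adD S.D p X)
  | nop {p q X Y} (hX : IsField X) (hY : IsField Y) : Fld p X → Fld q Y →
      IsLocal (sgn (p * q)) X Y →
      Fld (p + q) (nop (sgn (p * q)) X Y hX hY)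

variable {S}

theorem Fld.field {p : ZMod 2} {X : ℤ → Module.End ℂ V} (h : S.Fld p X) : IsField X := by
  induction h with
  | zero p => exact fun v => ⟨0, fun j _ => rfl⟩
  | add _ _ h h' => exact h.add h'
  | smul c _ h => exact h.smul c
  | one => exact fun v => ⟨0, fun j hj => by simp [idField, show j ≠ -1 by omega]⟩
  | gen g i => exact S.x_field g i
  | deriv _ h => exact h.deriv
  | @adD p X _ h =>
    intro v
    obtain ⟨N, hN⟩ := h v
    obtain ⟨N', hN'⟩ := h (S.D v)
    exact ⟨max N N', fun j hj => by simp [SUSYVA.adD, hN j (by omega), hN' j (by omega)]⟩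
  | nop hX hY _ _ _ _ _ => exact hX.nop hY

theorem cov_x_one (g : G) : IsCov (S.D * S.D) (S.x g 1) := by
  intro n v
  have h1 := fun v => LinearMap.congr_fun (S.D_x_one g n) v
  have h0 := fun v => LinearMap.congr_fun (S.D_x_zero g n) v
  simp only [LinearMap.sub_apply, LinearMap.smul_apply, Module.End.mul_apply, sgn_add,
    sgn_one] at h1 h0 ⊢
  have h1' : ∀ v, S.D (S.x g 1 n v) = S.x g 0 n v + sgn (S.par g) • S.x g 1 n (S.D v) :=
    fun v => by rw [← h1, sub_add_cancel]
  rw [← h0, h1', map_add, map_smul, h1', smul_add, smul_smul, sgn_mul_self]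
  module

theorem cov_x_zero (g : G) : IsCov (S.D * S.D) (S.x g 0) := by
  intro n v
  have h1 := fun v => LinearMap.congr_fun (S.D_x_one g (n - 1)) v
  have h0 := fun v => LinearMap.congr_fun (S.D_x_zero g n) v
  simp only [LinearMap.sub_apply, LinearMap.smul_apply, Module.End.mul_apply, sgn_add,
    sgn_one] at h1 h0 ⊢
  have h0' : ∀ v, S.D (S.x g 0 n v) = (-(n : ℂ)) • S.x g 1 (n - 1) v +
      (sgn (S.par g) * -1) • S.x g 0 n (S.D v) :=
    fun v => by rw [← h0, sub_add_cancel]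
  rw [← h1, h0', map_add, map_smul, map_smul, h0', smul_add, smul_smul _ _ (S.x g 0 n _),
    show sgn (S.par g) * -1 * (sgn (S.par g) * -1) = 1 by
      linear_combination sgn_mul_self (S.par g)]
  module

theorem zmod2 (i : ZMod 2) : i = 0 ∨ i = 1 := by
  revert i; decide

theorem Fld.cov {p : ZMod 2} {X : ℤ → Module.End ℂ V} (h : S.Fld p X) :
    IsCov (S.D * S.D) X := by
  induction h with
  | zero p => intro n v; simp
  | add _ _ h h' =>
    intro n v
    have := h n v
    have := h' n v
    simp only [Pi.add_apply, LinearMap.add_apply, map_add, smul_add] at *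
    rw [← h n v, ← h' n v]
    abel
  | smul c _ h =>
    intro n v
    simp only [Pi.smul_apply, LinearMap.smul_apply, map_smul]
    rw [smul_comm, ← h n v, smul_sub]
  | one =>
    intro n v
    simp only [idField]
    by_cases h1 : n = -1
    · simp [h1]
    · by_cases h2 : n = 0
      · simp [h2]
      · simp [h1, show n - 1 ≠ -1 by omega]
  | gen g i => rcases zmod2 i with rfl | rfl; exacts [cov_x_zero g, cov_x_one g]
  | deriv _ h =>
    intro n v
    simp only [SUSYVA.deriv, LinearMap.smul_apply, map_smul]
    rw [← smul_sub, h]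
  | @adD p X _ h =>
    intro n v
    have h1 := h n v
    have h2 := h n (S.D v)
    simp only [SUSYVA.adD, LinearMap.sub_apply, LinearMap.smul_apply, Module.End.mul_apply,
      map_sub, map_smul] at *
    have h3 := congrArg S.D h1
    simp only [map_sub, map_smul] at h3
    rw [smul_sub, smul_comm _ (sgn p), ← h2, ← h3, smul_sub]
    abel
  | nop hX hY _ _ _ h h' => exact h.nop hX hY h'

theorem Fld.parity {p : ZMod 2} {X : ℤ → Module.End ℂ V} (h : S.Fld p X) (n : ℤ) (v : V) :
    S.P (X n v) = sgn p • X n (S.P v) := by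
  induction h generalizing n v with
  | zero p => simp
  | add _ _ h h' => simp [h, h']
  | @smul p X c _ h => simp [h, smul_comm c (sgn p)]
  | one => simp only [idField]; split_ifs <;> simp
  | gen g i => exact S.P_x g i n v
  | @deriv p X _ h => simp [SUSYVA.deriv, h, smul_comm _ (sgn p)]
  | @adD p X _ h =>
    simp only [SUSYVA.adD, LinearMap.sub_apply, LinearMap.smul_apply, Module.End.mul_apply,
      map_sub, map_smul, P_D, h, map_neg, sgn_add, sgn_one]
    module
  | @nop p q X Y hX hY _ _ hl h h' =>
    simp only [nop_apply]
    have e1 := S.P.toAddMonoidHom.map_finsum (nopTerm_finite (sgn (p * q)) hX hY n v)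
    simp only [LinearMap.toAddMonoidHom_coe] at e1
    rw [e1, smul_finsum' _ (nopTerm_finite (sgn (p * q)) hX hY n (S.P v))]
    congr 1
    funext j
    simp only [nopTerm]
    split_ifs
    · rw [h, h', map_smul, smul_smul, sgn_add]
    · rw [map_smul, h', h, map_smul, sgn_add]
      module

theorem Fld.vac {p : ZMod 2} {X : ℤ → Module.End ℂ V} (h : S.Fld p X) (n : ℤ) (hn : 0 ≤ n) :
    X n S.vac = 0 := by
  induction h generalizing n with
  | zero p => simp
  | add _ _ h h' => simp [h n hn, h' n hn]
  | @smul p X c _ h => simp [h n hn]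
  | one => simp [idField, show n ≠ -1 by omega]
  | gen g i => exact S.x_vac g i n hn
  | @deriv p X _ h =>
    rcases hn.eq_or_lt with rfl | hn
    · simp [SUSYVA.deriv]
    · simp [SUSYVA.deriv, h (n - 1) (by omega)]
  | @adD p X _ h => simp [SUSYVA.adD, h n hn, S.D_vac]
  | @nop p q X Y hX hY _ _ hl h h' =>
    rw [nop_apply]
    refine finsum_eq_zero_of_forall_eq_zero fun j => ?_
    simp only [nopTerm]
    split_ifs
    · rw [h' _ (by omega), map_zero]
    · rw [h _ (by omega), map_zero, smul_zero]

theorem nop_neg_one_vac {p q : ZMod 2} {X Y : ℤ → Module.End ℂ V} (hX : S.Fld p X)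
    (hY : S.Fld q Y) : nop (sgn (p * q)) X Y hX.field hY.field (-1) S.vac =
      X (-1) (Y (-1) S.vac) := by
  rw [nop_apply, finsum_eq_single _ (-1)]
  · simp [nopTerm]
  · intro j hj
    simp only [nopTerm]
    split_ifs
    · rw [hY.vac _ (by omega), map_zero]
    · rw [hX.vac _ (by omega), map_zero, smul_zero]

theorem local_adD {p q : ZMod 2} {X Z : ℤ → Module.End ℂ V} (h : IsLocal (sgn (p * q)) X Z)
    (h' : IsLocal (sgn (p * (q + 1))) X (SUSYVA.adD S.D q Z)) :
    IsLocal (sgn ((p + 1) * q)) (SUSYVA.adD S.D p X) Z := by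
  obtain ⟨N, hN⟩ := h
  obtain ⟨N', hN'⟩ := h'
  refine ⟨max N N', ?_⟩
  have e : scomm (sgn ((p + 1) * q)) (SUSYVA.adD S.D p X) Z =
      (fun m n => (LinearMap.mulLeft ℂ S.D - sgn (p + q) • LinearMap.mulRight ℂ S.D)
        (scomm (sgn (p * q)) X Z m n)) -
      sgn p • scomm (sgn (p * (q + 1))) X (SUSYVA.adD S.D q Z) := by
    funext m n
    simp only [scomm, SUSYVA.adD, LinearMap.sub_apply, LinearMap.smul_apply, Pi.sub_apply,
      Pi.smul_apply, LinearMap.mulLeft_apply, LinearMap.mulRight_apply, mul_add, add_mul, mul_one,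
      one_mul, sgn_add, mul_sub, sub_mul, smul_sub, smul_mul_assoc, mul_smul_comm, smul_smul,
      mul_assoc]
    rw [show sgn p * (sgn (p * q) * sgn p) = sgn (p * q) by
        linear_combination sgn (p * q) * sgn_mul_self p,
      show sgn p * (sgn (p * q) * (sgn p * sgn q)) = sgn (p * q) * sgn q by
        linear_combination sgn (p * q) * sgn q * sgn_mul_self p,
      show sgn p * (sgn q * sgn (p * q)) = sgn p * sgn q * sgn (p * q) by ring]
    module
  rw [e, map_sub, map_smul, mulSub_pow_mono (le_max_right _ _) hN', mulSub_pow_map,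
    mulSub_pow_mono (le_max_left _ _) hN]
  funext m n
  simp

theorem sgn_sq_one (p q : ZMod 2) : sgn (p * q) * sgn (q * p) = 1 := by
  rw [mul_comm q p, sgn_mul_self]

theorem local_symm {p q : ZMod 2} {X Y : ℤ → Module.End ℂ V} (h : IsLocal (sgn (p * q)) X Y) :
    IsLocal (sgn (q * p)) Y X := by
  rw [mul_comm q p]
  exact h.symm (sgn_mul_self _)

theorem adD_x_one (g : G) : SUSYVA.adD S.D (S.par g + 1 + 1) (S.x g 1) = S.x g 0 := by
  funext n
  rw [add_assoc, show (1 : ZMod 2) + 1 = 0 from rfl, add_zero]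
  exact S.D_x_one g n

theorem adD_x_zero (g : G) :
    SUSYVA.adD S.D (S.par g + 0 + 1) (S.x g 0) = SUSYVA.deriv (S.x g 1) := by
  funext n
  rw [add_zero]
  exact S.D_x_zero g n

theorem local_zero (ε : ℂ) (Y : ℤ → Module.End ℂ V) : IsLocal ε 0 Y := by
  refine ⟨0, ?_⟩
  funext m n
  simp [scomm]

theorem local_one (Y : ℤ → Module.End ℂ V) : IsLocal 1 idField Y := by
  refine ⟨0, ?_⟩
  funext m n
  simp only [scomm, idField, pow_zero, Module.End.one_apply]
  split_ifs <;> simp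

theorem Fld.local_gen {p : ZMod 2} {X : ℤ → Module.End ℂ V} (h : S.Fld p X) (g : G)
    (i : ZMod 2) : IsLocal (sgn (p * (S.par g + i + 1))) X (S.x g i) := by
  induction h generalizing i with
  | zero p => exact local_zero _ _
  | add _ _ h h' => exact (h i).add_left (h' i)
  | smul c _ h => exact (h i).smul_left c
  | one => rw [zero_mul, sgn_zero]; exact local_one _
  | gen h k => exact S.x_local _ _ _ _
  | deriv _ h => exact (h i).deriv_left
  | @adD p X _ h =>
    refine local_adD (h i) ?_
    rcases zmod2 i with rfl | rfl
    · rw [adD_x_zero]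
      have := local_symm (local_symm (h 1)).deriv_left
      convert this using 3
      ring
    · rw [adD_x_one]
      convert h 0 using 3
      rw [add_assoc (S.par g), show (1 : ZMod 2) + 1 = 0 from rfl]
  | @nop p q X Y hX hY _ _ hl h h' =>
    apply local_symm
    rw [mul_add, sgn_add]
    refine IsLocal.nop_right hX hY (local_symm (h i)) (local_symm (h' i)) hl

theorem Fld.isLocal {p q : ZMod 2} {X Z : ℤ → Module.End ℂ V} (hX : S.Fld p X)
    (hZ : S.Fld q Z) : IsLocal (sgn (p * q)) X Z := by
  induction hZ generalizing p X with
  | zero q =>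
    rw [mul_comm]
    exact (local_zero _ _).symm (sgn_mul_self _)
  | add _ _ h h' => exact local_symm ((local_symm (h hX)).add_left (local_symm (h' hX)))
  | smul c _ h => exact local_symm ((local_symm (h hX)).smul_left c)
  | one =>
    apply local_symm
    rw [zero_mul, sgn_zero]
    exact local_one _
  | gen g i => exact hX.local_gen g i
  | deriv _ h => exact local_symm (local_symm (h hX)).deriv_left
  | @adD q Z _ h => exact local_symm (local_adD (local_symm (h hX)) (local_symm (h hX.adD)))
  | @nop q r Y Z hY hZ _ _ hl h h' =>
    rw [mul_add, sgn_add]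
    exact IsLocal.nop_right hY hZ (h hX) (h' hX) hl

theorem Fld.neg_one {p : ZMod 2} {X : ℤ → Module.End ℂ V} (hX : S.Fld p X) (k : ℕ) :
    ∃ X', S.Fld p X' ∧ X' (-1) = X (-1 - k) := by
  induction k generalizing X with
  | zero => exact ⟨X, hX, by simp⟩
  | succ k ih =>
    obtain ⟨X', h1, h2⟩ := ih (hX.deriv.smul ((k : ℂ) + 1)⁻¹)
    refine ⟨X', h1, ?_⟩
    rw [h2]
    simp only [Pi.smul_apply, SUSYVA.deriv, smul_smul]
    have h0 : (k : ℂ) + 1 ≠ 0 := by exact_mod_cast Nat.succ_ne_zero k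
    push_cast
    rw [show -1 - (k : ℤ) - 1 = -1 - (k + 1) by ring,
      show ((k : ℂ) + 1)⁻¹ * -(-1 - k) = 1 by field_simp; ring, one_smul]

/-- Goddard's uniqueness theorem. -/
theorem eq_zero_of {p : ZMod 2} {X : ℤ → Module.End ℂ V} (hcov : IsCov (S.D * S.D) X)
    (hvac : ∀ n, 0 ≤ n → X n S.vac = 0)
    (hloc : ∀ g i, IsLocal (sgn (p * (S.par g + i + 1))) X (S.x g i))
    (h : X (-1) S.vac = 0) : X = 0 := by
  have h1 : ∀ k : ℕ, X (-1 - k) S.vac = 0 := by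
    intro k
    induction k with
    | zero => simpa using h
    | succ k ih =>
      have := hcov (-1 - k) S.vac
      rw [ih, map_zero, Module.End.mul_apply, S.D_vac, map_zero, map_zero, sub_zero] at this
      have h0 : (k : ℂ) + 1 ≠ 0 := by exact_mod_cast Nat.succ_ne_zero k
      push_cast at this ⊢
      rw [show -1 - (k : ℤ) - 1 = -1 - (k + 1) by ring] at this
      refine (smul_eq_zero.1 this.symm).resolve_left ?_
      rwa [show -(-1 - (k : ℂ)) = k + 1 by ring]
  have h2 : ∀ m, X m S.vac = 0 := by
    intro m
    by_cases hm : 0 ≤ m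
    · exact hvac m hm
    · have := h1 (-1 - m).toNat
      rwa [show -1 - ((-1 - m).toNat : ℤ) = m by omega] at this
  let N : Submodule ℂ V := ⨅ m, LinearMap.ker (X m)
  have h3 := S.generates N (by simpa [N] using h2) (fun g i m _ v hv => by
    simp only [N, Submodule.mem_iInf, LinearMap.mem_ker] at hv ⊢
    exact fun n => (hloc g i).apply_eq_zero (S.x_field g i) hv n m)
  funext m
  ext v
  have := h3 v
  simp only [N, Submodule.mem_iInf, LinearMap.mem_ker] at this
  exact this m

theorem Fld.eq_zero {p : ZMod 2} {X : ℤ → Module.End ℂ V} (hX : S.Fld p X)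
    (h : X (-1) S.vac = 0) : X = 0 :=
  eq_zero_of hX.cov hX.vac hX.local_gen h

theorem Fld.ext {p : ZMod 2} {X Y : ℤ → Module.End ℂ V} (hX : S.Fld p X) (hY : S.Fld p Y)
    (h : X (-1) S.vac = Y (-1) S.vac) : X = Y := by
  have := (hX.add (hY.smul (-1))).eq_zero (by simp [h])
  rwa [neg_one_smul, ← sub_eq_add_neg, sub_eq_zero] at this

variable (S)

/-- The space of fields of parity `p`. -/
def fields (p : ZMod 2) : Submodule ℂ (ℤ → Module.End ℂ V) where
  carrier := {X | S.Fld p X}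
  add_mem' := Fld.add
  zero_mem' := Fld.zero p
  smul_mem' c _ h := Fld.smul c h

/-- The field-state correspondence. -/
def ev : (S.fields 0 × S.fields 1) →ₗ[ℂ] V where
  toFun X := X.1.1 (-1) S.vac + X.2.1 (-1) S.vac
  map_add' X Y := by simp; abel
  map_smul' c X := by simp

theorem ev_injective : Function.Injective S.ev := by
  rw [injective_iff_map_eq_zero]
  rintro ⟨⟨X, hX⟩, ⟨Y, hY⟩⟩ h
  have h1 : X (-1) S.vac + Y (-1) S.vac = 0 := h
  have h2 := congrArg S.P h1
  rw [map_add, Fld.parity hX, Fld.parity hY, S.P_vac, map_zero, sgn_zero, sgn_one] at h2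
  have hX0 : X (-1) S.vac = 0 := by
    linear_combination (norm := module) (1 / 2 : ℂ) • h1 + (1 / 2 : ℂ) • h2
  have hY0 : Y (-1) S.vac = 0 := by rwa [hX0, zero_add] at h1
  have eX := Fld.eq_zero hX hX0
  have eY := Fld.eq_zero hY hY0
  subst eX
  subst eY
  rfl

theorem ev_surjective : Function.Surjective S.ev := by
  intro v
  refine S.generates (LinearMap.range S.ev) ⟨(⟨idField, Fld.one⟩, 0), by simp [ev, idField]⟩
    ?_ v
  rintro g i m hm _ ⟨⟨⟨X, hX⟩, ⟨Y, hY⟩⟩, rfl⟩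
  obtain ⟨Z, hZ, hZm⟩ := Fld.neg_one (Fld.gen (S := S) g i) (-1 - m).toNat
  rw [show -1 - ((-1 - m).toNat : ℤ) = m by omega] at hZm
  have hZX := Fld.nop hZ.field (Fld.field hX) hZ hX (hZ.isLocal hX)
  have hZY := Fld.nop hZ.field (Fld.field hY) hZ hY (hZ.isLocal hY)
  have e1 := nop_neg_one_vac hZ hX
  have e2 := nop_neg_one_vac hZ hY
  rw [hZm] at e1 e2
  have e3 : S.x g i m (S.ev (⟨X, hX⟩, ⟨Y, hY⟩)) =
      S.x g i m (X (-1) S.vac) + S.x g i m (Y (-1) S.vac) := by simp [ev]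
  rw [e3, ← e1, ← e2]
  generalize S.par g + i + 1 = r at *
  rcases zmod2 r with rfl | rfl
  · exact ⟨(⟨_, hZX⟩, ⟨_, hZY⟩), rfl⟩
  · exact ⟨(⟨_, hZY⟩, ⟨_, hZX⟩), add_comm _ _⟩

/-- The inverse of the field-state correspondence. -/
noncomputable def evEquiv : (S.fields 0 × S.fields 1) ≃ₗ[ℂ] V :=
  LinearEquiv.ofBijective S.ev ⟨S.ev_injective, S.ev_surjective⟩

/-- The superfield attached to a pair of fields. -/
def superfield : (S.fields 0 × S.fields 1) →ₗ[ℂ] ℤ → ZMod 2 → Module.End ℂ V where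
  toFun X n i := if i = 1 then X.1.1 n + X.2.1 n
    else SUSYVA.adD S.D 0 X.1.1 n + SUSYVA.adD S.D 1 X.2.1 n
  map_add' X Y := by
    funext n i
    simp only [Pi.add_apply]
    split_ifs
    · simp only [Prod.fst_add, Prod.snd_add, Submodule.coe_add, Pi.add_apply]; abel
    · simp only [Prod.fst_add, Prod.snd_add, Submodule.coe_add, Pi.add_apply, SUSYVA.adD,
        mul_add, add_mul, smul_add]
      abel
  map_smul' c X := by
    funext n i
    simp only [Pi.smul_apply, RingHom.id_apply]
    split_ifs
    · simp
    · simp only [Prod.smul_fst, Prod.smul_snd, Submodule.coe_smul, Pi.smul_apply, SUSYVA.adD,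
        mul_smul_comm, smul_mul_assoc, smul_add, smul_sub]
      rw [smul_comm c (sgn 0), smul_comm c (sgn 1)]

/-- The subspace of vectors of parity `p`. -/
def grade (p : ZMod 2) : Submodule ℂ V where
  carrier := {v | S.P v = sgn p • v}
  add_mem' {v w} hv hw := by
    rw [Set.mem_ofPred_eq] at *
    rw [map_add, hv, hw, smul_add]
  zero_mem' := by simp
  smul_mem' c v hv := by
    rw [Set.mem_ofPred_eq] at *
    rw [map_smul, hv, smul_comm]

theorem mem_grade {p : ZMod 2} {v : V} : v ∈ S.grade p ↔ S.P v = sgn p • v := Iff.rfl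

theorem grade_internal : DirectSum.IsInternal S.grade := by
  rw [DirectSum.isInternal_submodule_iff_isCompl S.grade (i := 0) (j := 1) (by decide)
    (by ext i; rcases zmod2 i with rfl | rfl <;> simp)]
  constructor
  · rw [Submodule.disjoint_def]
    intro v h0 h1
    rw [mem_grade] at h0 h1
    rw [h0, sgn_zero, sgn_one] at h1
    linear_combination (norm := module) (1 / 2 : ℂ) • h1
  · rw [codisjoint_iff, eq_top_iff]
    intro v _
    rw [Submodule.mem_sup]
    refine ⟨(1 / 2 : ℂ) • (v + S.P v), ?_, (1 / 2 : ℂ) • (v - S.P v), ?_, by module⟩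
    · rw [mem_grade, map_smul, map_add, S.P_P, sgn_zero]
      module
    · rw [mem_grade, map_smul, map_sub, S.P_P, sgn_one]
      module

theorem exists_field {p : ZMod 2} {v : V} (hv : v ∈ S.grade p) : ∃ X, S.Fld p X ∧
    X (-1) S.vac = v ∧ (∀ n, S.superfield (S.evEquiv.symm v) n 1 = X n) ∧
    (∀ n, S.superfield (S.evEquiv.symm v) n 0 = SUSYVA.adD S.D p X n) := by
  obtain ⟨⟨⟨X, hX⟩, ⟨Y, hY⟩⟩, rfl⟩ := S.evEquiv.surjective v
  rw [S.evEquiv.symm_apply_apply]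
  have h0 : S.evEquiv (⟨X, hX⟩, ⟨Y, hY⟩) = X (-1) S.vac + Y (-1) S.vac := rfl
  rw [h0] at hv ⊢
  rw [mem_grade, map_add, Fld.parity hX, Fld.parity hY, S.P_vac, sgn_zero, sgn_one] at hv
  rcases zmod2 p with rfl | rfl
  · have hY0 : Y (-1) S.vac = 0 := by
      rw [sgn_zero] at hv
      linear_combination (norm := module) (-1 / 2 : ℂ) • hv
    have eY := Fld.eq_zero hY hY0
    subst eY
    exact ⟨X, hX, by simp, by simp [superfield], by simp [superfield, SUSYVA.adD]⟩
  · have hX0 : X (-1) S.vac = 0 := by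
      rw [sgn_one] at hv
      linear_combination (norm := module) (1 / 2 : ℂ) • hv
    have eX := Fld.eq_zero hX hX0
    subst eX
    exact ⟨Y, hY, by simp, by simp [superfield], by simp [superfield, SUSYVA.adD]⟩

theorem exists_field' {p : ZMod 2} {v : V} (hv : v ∈ S.grade p) (i : ZMod 2) :
    S.Fld (p + i + 1) (fun n => S.superfield (S.evEquiv.symm v) n i) := by
  obtain ⟨X, hX, -, h1, h0⟩ := S.exists_field hv
  rcases zmod2 i with rfl | rfl
  · simp only [h0, add_zero]
    exact hX.adD
  · simp only [h1, add_assoc, show (1 : ZMod 2) + 1 = 0 from rfl, add_zero]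
    exact hX

/-- The SUSY vertex algebra generated by a system of local superfields. -/
noncomputable def toSUSYVertexAlgebra : SUSYVertexAlgebra V where
  gr := S.grade
  gr_internal := S.grade_internal
  vac := S.vac
  vac_mem := by rw [mem_grade, S.P_vac, sgn_zero, one_smul]
  D := S.D
  D_mem p v hv := by
    rw [mem_grade] at *
    rw [S.P_D, hv, map_smul, sgn_add, sgn_one]
    module
  mode := S.superfield ∘ₗ S.evEquiv.symm.toLinearMap
  mode_mem p q a ha v hv j i := by
    have h := (S.exists_field' ha i).parity j v
    rw [mem_grade] at *
    rw [LinearMap.comp_apply]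
    refine h.trans ?_
    rw [hv, map_smul, smul_smul, ← sgn_add]
    congr 2
    ring
  mode_field a v := by
    have : ∀ i, IsField (fun n => S.superfield (S.evEquiv.symm a) n i) := by
      intro i
      obtain ⟨⟨⟨X, hX⟩, ⟨Y, hY⟩⟩, rfl⟩ := S.evEquiv.surjective a
      rw [S.evEquiv.symm_apply_apply]
      rcases zmod2 i with rfl | rfl
      · exact (Fld.adD hX).field.add (Fld.adD hY).field
      · exact (Fld.field hX).add (Fld.field hY)
    obtain ⟨N, hN⟩ := this 0 v
    obtain ⟨N', hN'⟩ := this 1 v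
    refine ⟨max N N', fun j hj i => ?_⟩
    rcases zmod2 i with rfl | rfl
    · exact hN j (by omega)
    · exact hN' j (by omega)
  D_vac := S.D_vac
  mode_vac a j hj i := by
    obtain ⟨⟨⟨X, hX⟩, ⟨Y, hY⟩⟩, rfl⟩ := S.evEquiv.surjective a
    rw [LinearMap.comp_apply, LinearEquiv.coe_coe, S.evEquiv.symm_apply_apply]
    have h1 := Fld.vac hX j hj
    have h2 := Fld.vac hY j hj
    rcases zmod2 i with rfl | rfl
    · simp [superfield, SUSYVA.adD, h1, h2, S.D_vac]
    · simp [superfield, h1, h2]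
  mode_neg_one_vac a := by
    obtain ⟨⟨⟨X, hX⟩, ⟨Y, hY⟩⟩, rfl⟩ := S.evEquiv.surjective a
    rw [LinearMap.comp_apply, LinearEquiv.coe_coe, S.evEquiv.symm_apply_apply]
    rfl
  D_mode_one p a ha j := by
    obtain ⟨X, hX, -, h1, h0⟩ := S.exists_field ha
    rw [LinearMap.comp_apply, LinearEquiv.coe_coe, h1, h0]
    rfl
  D_mode_zero p a ha j := by
    obtain ⟨X, hX, -, h1, h0⟩ := S.exists_field ha
    rw [LinearMap.comp_apply, LinearEquiv.coe_coe, h1, h0, neg_inj]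
    ext v
    rw [LinearMap.smul_apply, ← hX.cov j v]
    simp only [SUSYVA.adD, LinearMap.sub_apply, LinearMap.smul_apply, Module.End.mul_apply,
      map_sub, map_smul, sgn_add, sgn_one, smul_sub, smul_smul]
    rw [show sgn p * -1 * sgn p = -1 by linear_combination - sgn_mul_self p]
    module
  locality p q a ha b hb := by
    have h : ∀ i k, ∃ N : ℕ, (mulSub ^ N) (scomm (sgn ((p + i + 1) * (q + k + 1)))
        (fun n => S.superfield (S.evEquiv.symm a) n i)
        (fun n => S.superfield (S.evEquiv.symm b) n k)) = 0 := fun i k =>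
      (S.exists_field' ha i).isLocal (S.exists_field' hb k)
    choose N hN using h
    refine ⟨N 0 0 + N 0 1 + N 1 0 + N 1 1, fun i k => mulSub_pow_mono ?_ (hN i k)⟩
    rcases zmod2 i with rfl | rfl <;> rcases zmod2 k with rfl | rfl <;> omega

end GenSystem

/-! ### The supercommutators of two fields -/

section jprod

variable {V : Type*} [AddCommGroup V] [Module ℂ V]

/-- Coefficients of the `j`-th product of two fields, `j ≥ 0`. -/
def jprod (ε : ℂ) (A B : ℤ → Module.End ℂ V) (j : ℕ) : ℤ → Module.End ℂ V :=
  fun n => (mulSub ^ j) (scomm ε A B) 0 n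

theorem eq_zero_of_jprod {M : Type*} [AddCommGroup M] [Module ℂ M] (N : ℕ)
    {f : ℤ → ℤ → M} (hf : (mulSub ^ N) f = 0) (h : ∀ j n, (mulSub ^ j) f 0 n = 0) : f = 0 := by
  induction N generalizing f with
  | zero => simpa using hf
  | succ N ih =>
    rw [pow_succ, Module.End.mul_apply] at hf
    have h0 := ih hf (fun j n => by
      rw [← Module.End.mul_apply, ← pow_succ]
      exact h _ _)
    have h1 : ∀ m n, f (m + 1) n = f m (n + 1) := fun m n =>
      sub_eq_zero.1 (congrFun (congrFun h0 m) n)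
    have h2 : ∀ n, f 0 n = 0 := fun n => h 0 n
    have h3 : ∀ (k : ℕ) n, f k n = 0 := by
      intro k
      induction k with
      | zero => exact h2
      | succ k ihk => intro n; push_cast; rw [h1, ihk]
    have h4 : ∀ (k : ℕ) n, f (-k) n = 0 := by
      intro k
      induction k with
      | zero => simpa using h2
      | succ k ihk =>
        intro n
        have := h1 (-(k + 1 : ℕ)) (n - 1)
        rw [sub_add_cancel] at this
        rw [← this, show -((k + 1 : ℕ) : ℤ) + 1 = -k by push_cast; ring, ihk]
    funext m n
    rcases Int.eq_nat_or_neg m with ⟨k, rfl | rfl⟩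
    exacts [h3 k n, h4 k n]

theorem mulXW_kill {M : Type*} [AddCommGroup M] [Module ℂ M] {F : ℤ → ℤ → ℤ → M} {K L N : ℕ}
    (h1 : (mulXZ ^ K) ((mulXW ^ L) F) = 0) (h2 : (mulZW ^ N) F = 0) :
    (mulXW ^ (K + N + L)) F = 0 := by
  have key : ∀ (m i j : ℕ), K + N ≤ i + j + m →
      (mulXW ^ m) ((mulXZ ^ i) ((mulZW ^ j) ((mulXW ^ L) F))) = 0 := by
    intro m
    induction m with
    | zero =>
      intro i j hij
      rw [pow_zero, Module.End.one_apply]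
      by_cases hi : K ≤ i
      · obtain ⟨k, rfl⟩ := Nat.exists_eq_add_of_le hi
        rw [← Module.End.mul_apply, (commute_xz_zw.pow_pow _ _).eq, Module.End.mul_apply,
          add_comm K k, pow_add, Module.End.mul_apply, h1, map_zero, map_zero]
      · obtain ⟨k, rfl⟩ := Nat.exists_eq_add_of_le (show N ≤ j by omega)
        rw [← Module.End.mul_apply (mulZW ^ _), ← (commute_xw_zw.pow_pow _ _).eq,
          Module.End.mul_apply, add_comm N k, pow_add, Module.End.mul_apply, h2, map_zero,
          map_zero, map_zero]
    | succ m ih =>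
      intro i j hij
      have c1 := (commute_xz_zw (M := M)).pow_pow i 1
      rw [pow_one] at c1
      have e4 : mulXW ((mulXZ ^ i) ((mulZW ^ j) ((mulXW ^ L) F))) =
          (mulXZ ^ (i + 1)) ((mulZW ^ j) ((mulXW ^ L) F)) +
            (mulXZ ^ i) ((mulZW ^ (j + 1)) ((mulXW ^ L) F)) := by
        rw [mulXW_eq, LinearMap.add_apply, ← mulXW_eq, pow_succ' _ i, pow_succ' _ j,
          Module.End.mul_apply, Module.End.mul_apply, ← Module.End.mul_apply mulZW, ← c1.eq,
          Module.End.mul_apply]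
      rw [pow_succ, Module.End.mul_apply, e4, map_add, ih _ _ (by omega), ih _ _ (by omega),
        add_zero]
  rw [pow_add, Module.End.mul_apply]
  simpa using key (K + N) 0 0 (by omega)

/-- Dong's lemma for the products with nonnegative index. -/
theorem IsLocal.jprod_right {ε₁ ε₂ ε₃ : ℂ} {A B C : ℤ → Module.End ℂ V}
    (h₁ : IsLocal ε₁ C A) (h₂ : IsLocal ε₂ C B) (h₃ : IsLocal ε₃ A B) (j : ℕ) :
    IsLocal (ε₁ * ε₂) C (jprod ε₃ A B j) := by
  obtain ⟨K, hK⟩ := h₁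
  obtain ⟨L, hL⟩ := h₂
  obtain ⟨N, hN⟩ := h₃
  refine ⟨K + N + L, ?_⟩
  let φ : ℤ → Module.End ℂ V →ₗ[ℂ] Module.End ℂ V := fun m =>
    LinearMap.mulLeft ℂ (C m) - (ε₁ * ε₂) • LinearMap.mulRight ℂ (C m)
  let F : ℤ → ℤ → ℤ → Module.End ℂ V := fun m j n => φ m (scomm ε₃ A B j n)
  have h2 : (mulZW ^ N) F = 0 := by
    rw [mulZW_pow, hN]
    funext m j n
    simp
  have h1 : (mulXZ ^ K) ((mulXW ^ L) F) = 0 := by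
    have b1 : (mulXZ ^ K) (fun m j n => LinearMap.mulRight ℂ (B n) (scomm ε₁ C A m j)) = 0 := by
      rw [mulXZ_pow (fun n => LinearMap.mulRight ℂ (B n)), hK]; funext m j n; simp
    have b2 : (mulXW ^ L) (fun m j n => LinearMap.mulLeft ℂ (A j) (scomm ε₂ C B m n)) = 0 := by
      rw [mulXW_pow (fun j => LinearMap.mulLeft ℂ (A j)), hL]; funext m j n; simp
    have b3 : (mulXW ^ L) (fun m j n => LinearMap.mulRight ℂ (A j) (scomm ε₂ C B m n)) = 0 := by
      rw [mulXW_pow (fun j => LinearMap.mulRight ℂ (A j)), hL]; funext m j n; simp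
    have b4 : (mulXZ ^ K) (fun m j n => LinearMap.mulLeft ℂ (B n) (scomm ε₁ C A m j)) = 0 := by
      rw [mulXZ_pow (fun n => LinearMap.mulLeft ℂ (B n)), hK]; funext m j n; simp
    have e : F = (fun m j n => LinearMap.mulRight ℂ (B n) (scomm ε₁ C A m j)) +
        ε₁ • (fun m j n => LinearMap.mulLeft ℂ (A j) (scomm ε₂ C B m n)) -
        ε₃ • ((fun m j n => LinearMap.mulRight ℂ (A j) (scomm ε₂ C B m n)) +
          ε₂ • (fun m j n => LinearMap.mulLeft ℂ (B n) (scomm ε₁ C A m j))) := by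
      funext m j n
      simp only [F, φ, scomm, Pi.add_apply, Pi.sub_apply, Pi.smul_apply, LinearMap.sub_apply,
        LinearMap.smul_apply, LinearMap.mulLeft_apply, LinearMap.mulRight_apply, mul_sub, sub_mul,
        smul_mul_assoc, mul_smul_comm, smul_sub, smul_smul, mul_assoc]
      module
    have hc : ∀ p : ℤ → ℤ → ℤ → Module.End ℂ V, (mulXZ ^ K) ((mulXW ^ L) p) =
        (mulXW ^ L) ((mulXZ ^ K) p) := fun p => by
      rw [← Module.End.mul_apply, ← Module.End.mul_apply, (commute_xw_xz.pow_pow L K).eq]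
    simp only [e, map_sub, map_add, map_smul, b2, b3, hc, b1, b4, map_zero, smul_zero, add_zero,
      sub_zero]
  have h3 := mulXW_kill h1 h2
  have h4 : scomm (ε₁ * ε₂) C (jprod ε₃ A B j) = fun m n => (mulZW ^ j) F m 0 n := by
    funext m n
    rw [mulZW_pow]
    rfl
  have h5 : ∀ (k : ℕ) (H : ℤ → ℤ → ℤ → Module.End ℂ V),
      (mulSub ^ k) (fun m n => H m 0 n) = fun m n => (mulXW ^ k) H m 0 n := by
    intro k
    induction k with
    | zero => intro H; rfl
    | succ k ih =>
      intro H
      rw [pow_succ, pow_succ, Module.End.mul_apply, Module.End.mul_apply, ← ih]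
      rfl
  rw [h4, h5, ← Module.End.mul_apply, (commute_xw_zw.pow_pow _ _).eq, Module.End.mul_apply, h3,
    map_zero]
  rfl

theorem IsCov.jprod {T : Module.End ℂ V} {ε : ℂ} {A B : ℤ → Module.End ℂ V}
    (tA : IsCov T A) (tB : IsCov T B) (j : ℕ) : IsCov T (jprod ε A B j) := by
  have key : ∀ (m n : ℤ) (v : V), T ((mulSub ^ j) (scomm ε A B) m n v) -
      (mulSub ^ j) (scomm ε A B) m n (T v) =
      (-(m : ℂ)) • (mulSub ^ j) (scomm ε A B) (m - 1) n v +
      (-(n : ℂ)) • (mulSub ^ j) (scomm ε A B) m (n - 1) v := by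
    induction j with
    | zero =>
      intro m n v
      have tA' : ∀ n v, T (A n v) = A n (T v) + (-(n : ℂ)) • A (n - 1) v := fun n v => by
        rw [← tA, add_sub_cancel]
      have tB' : ∀ n v, T (B n v) = B n (T v) + (-(n : ℂ)) • B (n - 1) v := fun n v => by
        rw [← tB, add_sub_cancel]
      simp only [pow_zero, Module.End.one_apply, scomm, LinearMap.sub_apply,
        LinearMap.smul_apply, Module.End.mul_apply, map_sub, map_smul, tA', tB', map_add]
      module
    | succ j ih =>
      intro m n v
      have i1 := ih (m + 1) n v
      have i2 := ih m (n + 1) v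
      simp only [pow_succ', Module.End.mul_apply, mulSub_apply, LinearMap.sub_apply, map_sub,
        add_sub_cancel_right, sub_add_cancel] at *
      push_cast at i1 i2
      linear_combination (norm := module) i1 - i2
  intro n v
  have := key 0 n v
  simpa [SUSYVA.jprod] using this

theorem jprod_vac {ε : ℂ} {A B : ℤ → Module.End ℂ V} {v : V}
    (hA : ∀ n, 0 ≤ n → A n v = 0) (hB : ∀ n, 0 ≤ n → B n v = 0) (j : ℕ) :
    (∀ m n, 0 ≤ m → 0 ≤ n → (mulSub ^ j) (scomm ε A B) m n v = 0) ∧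
      (∀ m, 0 ≤ m → (mulSub ^ j) (scomm ε A B) m (-1) v = A (m + j) (B (-1) v)) := by
  induction j with
  | zero =>
    constructor
    · intro m n hm hn
      simp [scomm, hA m hm, hB n hn]
    · intro m hm
      simp [scomm, hA m hm]
  | succ j ih =>
    constructor
    · intro m n hm hn
      rw [pow_succ', Module.End.mul_apply, mulSub_apply, LinearMap.sub_apply,
        ih.1 _ _ (by omega) hn, ih.1 _ _ hm (by omega), sub_zero]
    · intro m hm
      rw [pow_succ', Module.End.mul_apply, mulSub_apply, LinearMap.sub_apply,
        ih.2 _ (by omega), show (-1 : ℤ) + 1 = 0 by ring, ih.1 _ _ hm le_rfl, sub_zero]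
      push_cast
      rw [add_right_comm, add_assoc]

end jprod

namespace GenSystem

variable {V : Type*} [AddCommGroup V] [Module ℂ V] {G : Type*} {S : GenSystem V G}

/-- The supercommutator of two fields whose only singular product is a multiple of the vacuum. -/
theorem Fld.scomm_eq {p q : ZMod 2} {X Y : ℤ → Module.End ℂ V} (hX : S.Fld p X) (hY : S.Fld q Y)
    (c : ℂ) (hc : c = 0 ∨ p + q = 0)
    (h : ∀ j : ℕ, X j (Y (-1) S.vac) = if j = 0 then c • S.vac else 0) (m n : ℤ) :
    scomm (sgn (p * q)) X Y m n = (if m + n = -1 then c else 0) • 1 := by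
  let f : ℤ → ℤ → Module.End ℂ V := fun m n => (if m + n = -1 then c else 0) • 1
  have hf : mulSub f = 0 := by
    funext m n
    rw [mulSub_apply]
    simp only [f]
    rw [show m + 1 + n = m + (n + 1) by ring, sub_self]
    rfl
  have hfpow : ∀ j : ℕ, 0 < j → (mulSub ^ j) f = 0 := fun j hj =>
    mulSub_pow_mono (N := 1) hj (by rwa [pow_one])
  have hj : ∀ j n, jprod (sgn (p * q)) X Y j n = (mulSub ^ j) f 0 n := by
    intro j n
    have hv := jprod_vac (ε := sgn (p * q)) hX.vac hY.vac j
    have hv1 := hv.2 0 le_rfl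
    rw [zero_add, h] at hv1
    have hloc : ∀ g i, IsLocal (sgn ((p + q) * (S.par g + i + 1)))
        (jprod (sgn (p * q)) X Y j) (S.x g i) := by
      intro g i
      apply local_symm
      rw [mul_add, sgn_add]
      exact IsLocal.jprod_right (local_symm (hX.local_gen g i)) (local_symm (hY.local_gen g i))
        (hX.isLocal hY) j
    rcases j with _ | j
    · rw [if_pos rfl] at hv1
      have hz : jprod (sgn (p * q)) X Y 0 + (-c) • idField = 0 := by
        rcases hc with rfl | hpq
        · rw [neg_zero, zero_smul, add_zero]
          exact eq_zero_of (hX.cov.jprod hY.cov 0) (fun n hn => hv.1 0 n le_rfl hn) hloc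
            (by rw [zero_smul] at hv1; exact hv1)
        · refine eq_zero_of (S := S) (p := p + q) (fun n v => ?_) (fun n hn => ?_)
            (fun g i => (hloc g i).add_left (IsLocal.smul_left _ ?_)) ?_
          · have h1 := hX.cov.jprod (ε := sgn (p * q)) hY.cov 0 n v
            have h2 := (Fld.one (S := S)).cov n v
            simp only [Pi.add_apply, Pi.smul_apply, LinearMap.add_apply, LinearMap.smul_apply,
              map_add, map_smul] at *
            linear_combination (norm := module) h1 + (-c) • h2
          · have h1 := hv.1 0 n le_rfl hn
            have h2 := (Fld.one (S := S)).vac n hn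
            simp only [Pi.add_apply, Pi.smul_apply, LinearMap.add_apply, LinearMap.smul_apply, h2,
              smul_zero, add_zero]
            exact h1
          · rw [hpq, zero_mul, sgn_zero]
            exact local_one _
          · simp only [Pi.add_apply, Pi.smul_apply, LinearMap.add_apply, LinearMap.smul_apply,
              idField, if_true, Module.End.one_apply]
            refine (congrArg (· + -c • S.vac) hv1).trans ?_
            module
      have := congrFun hz n
      simp only [Pi.add_apply, Pi.smul_apply, Pi.zero_apply, idField] at this
      rw [eq_neg_of_add_eq_zero_left this]
      simp only [f, pow_zero, Module.End.one_apply, zero_add]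
      split_ifs <;> simp
    · rw [hfpow _ (Nat.succ_pos j)]
      rw [if_neg (Nat.succ_ne_zero j)] at hv1
      have := eq_zero_of (S := S) (p := p + q) (hX.cov.jprod hY.cov (j + 1))
        (fun n hn => hv.1 0 n le_rfl hn) hloc hv1
      exact congrFun this n
  obtain ⟨N, hN⟩ := hX.isLocal hY
  have := eq_zero_of_jprod (N + 1) (f := scomm (sgn (p * q)) X Y - f)
    (by rw [map_sub, mulSub_pow_mono (Nat.le_succ N) hN, hfpow _ (Nat.succ_pos N), sub_zero])
    (fun j n => by
      rw [map_sub, Pi.sub_apply, Pi.sub_apply, ← hj]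
      exact sub_self _)
  exact congrFun (congrFun (sub_eq_zero.1 this) m) n

end GenSystem

namespace ChargedFermion

variable {A : Type*}

/-- Parities of the generators: `(a, false)` stands for `φ_a`, of the parity of `a`, and
`(a, true)` for `φ^ā`, of the opposite parity. -/
def genPar (par : A → ZMod 2) (g : A × Bool) : ZMod 2 := if g.2 then par g.1 + 1 else par g.1

/-- Generators of the algebra of modes: the coefficients `g_(m|i)` of the superfields of the
generators `φ_a`, `φ^ā`, and the odd operator `D`. -/
inductive Sym (A : Type*)
  | mode (g : A × Bool) (m : ℤ) (i : ZMod 2)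
  | D

/-- Parities of the generators of the algebra of modes. -/
def symPar (par : A → ZMod 2) : Sym A → ZMod 2
  | .mode g _ i => genPar par g + i + 1
  | .D => 1

open Classical in
/-- The coefficient of `δ_{m+n,-1}` in the supercommutator of `g_(m|i)` and `h_(n|k)`. It is
determined by `[φ_a _Λ φ^b̄] = δ_ab`, sesquilinearity and skew-symmetry. -/
noncomputable def pairing (par : A → ZMod 2) (g h : A × Bool) (i k : ZMod 2) : ℂ :=
  if h.1 = g.1 ∧ h.2 ≠ g.2 then
    if i = 0 ∧ k = 1 then 1 else if i = 1 ∧ k = 0 then -sgn (genPar par g) else 0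
  else 0

/-- Relations of the algebra of modes: the supercommutators of modes, and
`[D, g(z, θ)] = (∂_θ - θ ∂_z) g(z, θ)`. -/
inductive ModeRel (par : A → ZMod 2) : FreeAlgebra ℂ (Sym A) → FreeAlgebra ℂ (Sym A) → Prop
  | comm (g h m n i k) : ModeRel par
      (FreeAlgebra.ι ℂ (Sym.mode g m i) * FreeAlgebra.ι ℂ (Sym.mode h n k))
      (sgn ((genPar par g + i + 1) * (genPar par h + k + 1)) •
        (FreeAlgebra.ι ℂ (Sym.mode h n k) * FreeAlgebra.ι ℂ (Sym.mode g m i)) +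
        algebraMap ℂ _ (if m + n = -1 then pairing par g h i k else 0))
  | D_one (g m) : ModeRel par
      (FreeAlgebra.ι ℂ Sym.D * FreeAlgebra.ι ℂ (Sym.mode g m 1))
      (sgn (genPar par g) • (FreeAlgebra.ι ℂ (Sym.mode g m 1) * FreeAlgebra.ι ℂ Sym.D) +
        FreeAlgebra.ι ℂ (Sym.mode g m 0))
  | D_zero (g) (m : ℤ) : ModeRel par
      (FreeAlgebra.ι ℂ Sym.D * FreeAlgebra.ι ℂ (Sym.mode g m 0))
      (sgn (genPar par g + 1) • (FreeAlgebra.ι ℂ (Sym.mode g m 0) * FreeAlgebra.ι ℂ Sym.D) +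
        (-(m : ℂ)) • FreeAlgebra.ι ℂ (Sym.mode g (m - 1) 1))

/-- The associative superalgebra of modes. -/
abbrev ModeAlg (par : A → ZMod 2) : Type _ := RingQuot (ModeRel par)

/-- The class of a generator in the algebra of modes. -/
noncomputable def sym (par : A → ZMod 2) (s : Sym A) : ModeAlg par :=
  RingQuot.mkAlgHom ℂ (ModeRel par) (FreeAlgebra.ι ℂ s)

/-- The left ideal generated by `D` and the annihilation operators `g_(m|i)`, `m ≥ 0`. -/
noncomputable def annihilator (par : A → ZMod 2) : Submodule (ModeAlg par) (ModeAlg par) :=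
  Submodule.span (ModeAlg par)
    ({x | ∃ g m i, 0 ≤ m ∧ x = sym par (.mode g m i)} ∪ {sym par .D})

/-- The space of states: the module over the algebra of modes induced from the vacuum. -/
def Fock (par : A → ZMod 2) : Type _ :=
  ModeAlg par ⧸ (annihilator par).restrictScalars ℂ

noncomputable instance (par : A → ZMod 2) : AddCommGroup (Fock par) :=
  inferInstanceAs (AddCommGroup (ModeAlg par ⧸ (annihilator par).restrictScalars ℂ))

noncomputable instance (par : A → ZMod 2) : Module ℂ (Fock par) :=
  inferInstanceAs (Module ℂ (ModeAlg par ⧸ (annihilator par).restrictScalars ℂ))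

variable (par : A → ZMod 2)

/-- The vector `x|0⟩`. -/
noncomputable def ket : ModeAlg par →ₗ[ℂ] Fock par :=
  ((annihilator par).restrictScalars ℂ).mkQ

theorem ket_surjective : Function.Surjective (ket par) := Submodule.mkQ_surjective _

theorem ket_eq_zero {x : ModeAlg par} : ket par x = 0 ↔ x ∈ annihilator par :=
  Submodule.Quotient.mk_eq_zero _

/-- The action of the algebra of modes on the space of states. -/
noncomputable def act : ModeAlg par →ₐ[ℂ] Module.End ℂ (Fock par) :=
  AlgHom.ofLinearMap
    { toFun := fun x => Submodule.mapQ ((annihilator par).restrictScalars ℂ)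
        ((annihilator par).restrictScalars ℂ) (LinearMap.mulLeft ℂ x)
        fun y hy => (annihilator par).smul_mem x hy
      map_add' := fun x y => by
        refine LinearMap.ext fun v => ?_
        obtain ⟨z, rfl⟩ := ket_surjective par v
        exact (congrArg (ket par) (add_mul x y z)).trans (map_add _ _ _)
      map_smul' := fun c x => by
        refine LinearMap.ext fun v => ?_
        obtain ⟨z, rfl⟩ := ket_surjective par v
        exact (congrArg (ket par) (smul_mul_assoc c x z)).trans (map_smul _ _ _) }
    (by
      refine LinearMap.ext fun v => ?_
      obtain ⟨z, rfl⟩ := ket_surjective par v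
      exact congrArg (ket par) (one_mul z))
    (fun x y => by
      refine LinearMap.ext fun v => ?_
      obtain ⟨z, rfl⟩ := ket_surjective par v
      exact congrArg (ket par) (mul_assoc x y z))

@[simp] theorem act_ket (x y : ModeAlg par) : act par x (ket par y) = ket par (x * y) := rfl

theorem sym_comm (g h m n i k) : sym par (.mode g m i) * sym par (.mode h n k) =
    sgn ((genPar par g + i + 1) * (genPar par h + k + 1)) •
      (sym par (.mode h n k) * sym par (.mode g m i)) +
      algebraMap ℂ _ (if m + n = -1 then pairing par g h i k else 0) := by
  have := RingQuot.mkAlgHom_rel ℂ (ModeRel.comm (par := par) g h m n i k)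
  rw [map_mul, map_add, map_smul, map_mul, AlgHom.commutes] at this
  exact this

theorem sym_D_one (g m) : sym par .D * sym par (.mode g m 1) =
    sgn (genPar par g) • (sym par (.mode g m 1) * sym par .D) + sym par (.mode g m 0) := by
  have := RingQuot.mkAlgHom_rel ℂ (ModeRel.D_one (par := par) g m)
  rw [map_mul, map_add, map_smul, map_mul] at this
  exact this

theorem sym_D_zero (g) (m : ℤ) : sym par .D * sym par (.mode g m 0) =
    sgn (genPar par g + 1) • (sym par (.mode g m 0) * sym par .D) +
      (-(m : ℂ)) • sym par (.mode g (m - 1) 1) := by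
  have := RingQuot.mkAlgHom_rel ℂ (ModeRel.D_zero (par := par) g m)
  rw [map_mul, map_add, map_smul, map_smul, map_mul] at this
  exact this

theorem genPar_of_ne {g h : A × Bool} (h1 : h.1 = g.1) (h2 : h.2 ≠ g.2) :
    genPar par h = genPar par g + 1 := by
  obtain ⟨a, f⟩ := g
  obtain ⟨b, f'⟩ := h
  have h3 : ∀ q : ZMod 2, q = q + 1 + 1 := by decide
  dsimp only at h1
  subst h1
  cases f <;> cases f'
  · exact absurd rfl h2
  · rfl
  · exact h3 _
  · exact absurd rfl h2

theorem pairing_parity (g h : A × Bool) (i k : ZMod 2) :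
    pairing par g h i k = 0 ∨ genPar par g + i + 1 + (genPar par h + k + 1) = 0 := by
  unfold pairing
  split_ifs with h2 h3 h4
  · obtain ⟨rfl, rfl⟩ := h3
    rw [genPar_of_ne par h2.1 h2.2]
    generalize genPar par g = q
    right; revert q; decide
  · obtain ⟨rfl, rfl⟩ := h4
    rw [genPar_of_ne par h2.1 h2.2]
    generalize genPar par g = q
    right; revert q; decide
  · exact Or.inl rfl
  · exact Or.inl rfl

theorem sgn_mul_pairing (g h : A × Bool) (i k : ZMod 2) :
    pairing par g h i k =
      sgn (genPar par g + i + 1) * sgn (genPar par h + k + 1) * pairing par g h i k := by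
  rcases pairing_parity par g h i k with h0 | h0
  · rw [h0, mul_zero]
  · rw [← sgn_add, h0, sgn_zero, one_mul]

/-- The parity involution of the algebra of modes. -/
noncomputable def parityHom : ModeAlg par →ₐ[ℂ] ModeAlg par :=
  RingQuot.liftAlgHom ℂ ⟨FreeAlgebra.lift ℂ fun s => sgn (symPar par s) • sym par s, by
    intro x y h
    induction h with
    | comm g h m n i k =>
      simp only [map_mul, map_add, map_smul, FreeAlgebra.lift_ι_apply, AlgHom.commutes,
        symPar, smul_mul_assoc, mul_smul_comm, sym_comm par g h m n i k, smul_add]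
      congr 1
      · module
      · by_cases hp : m + n = -1
        swap
        · simp [hp]
        rw [if_pos hp]
        rw [Algebra.algebraMap_eq_smul_one, smul_smul, smul_smul,
          mul_comm (sgn _) (sgn _), ← sgn_mul_pairing]
    | D_one g m =>
      simp only [map_mul, map_add, map_smul, FreeAlgebra.lift_ι_apply,
        symPar, smul_mul_assoc, mul_smul_comm, sym_D_one par g m, smul_add]
      simp only [sgn_add, sgn_zero, sgn_one]
      module
    | D_zero g m =>
      simp only [map_mul, map_add, map_smul, FreeAlgebra.lift_ι_apply,
        symPar, smul_mul_assoc, mul_smul_comm, sym_D_zero par g m, smul_add]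
      simp only [sgn_add, sgn_zero, sgn_one]
      module⟩

theorem parityHom_sym (s : Sym A) : parityHom par (sym par s) = sgn (symPar par s) • sym par s := by
  simp [parityHom, sym]

theorem parityHom_mem {x : ModeAlg par} (hx : x ∈ annihilator par) :
    parityHom par x ∈ annihilator par := by
  induction hx using Submodule.span_induction with
  | mem x h =>
    have : ∃ s, x = sym par s := by
      rcases h with ⟨g, m, i, _, rfl⟩ | rfl
      exacts [⟨_, rfl⟩, ⟨_, rfl⟩]
    obtain ⟨s, rfl⟩ := this
    rw [parityHom_sym, Algebra.smul_def]
    exact (annihilator par).smul_mem _ (Submodule.subset_span h)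
  | zero => rw [map_zero]; exact Submodule.zero_mem _
  | add x y _ _ hx hy => rw [map_add]; exact Submodule.add_mem _ hx hy
  | smul a x _ hx =>
    rw [smul_eq_mul, map_mul]
    exact (annihilator par).smul_mem _ hx

/-- The parity involution of the space of states. -/
noncomputable def parity : Module.End ℂ (Fock par) :=
  Submodule.mapQ ((annihilator par).restrictScalars ℂ) ((annihilator par).restrictScalars ℂ)
    (parityHom par).toLinearMap fun _ hx => parityHom_mem par hx

theorem parity_ket (x : ModeAlg par) : parity par (ket par x) = ket par (parityHom par x) := rfl

theorem parityHom_parityHom (x : ModeAlg par) : parityHom par (parityHom par x) = x := by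
  have : (parityHom par).comp (parityHom par) = AlgHom.id ℂ _ := by
    apply RingQuot.ringQuot_ext'
    ext s
    change parityHom par (parityHom par (sym par s)) = sym par s
    rw [parityHom_sym, map_smul, parityHom_sym, smul_smul, sgn_mul_self, one_smul]
  exact DFunLike.congr_fun this x

theorem act_comm (g h m n i k) (v : Fock par) :
    act par (sym par (.mode g m i)) (act par (sym par (.mode h n k)) v) =
      sgn ((genPar par g + i + 1) * (genPar par h + k + 1)) •
        act par (sym par (.mode h n k)) (act par (sym par (.mode g m i)) v) +
      (if m + n = -1 then pairing par g h i k else 0) • v := by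
  have := LinearMap.congr_fun (congrArg (act par) (sym_comm par g h m n i k)) v
  rw [map_add, map_smul, map_mul, map_mul, AlgHom.commutes] at this
  simpa [Module.algebraMap_end_apply] using this

theorem act_D_one (g m) (v : Fock par) :
    act par (sym par .D) (act par (sym par (.mode g m 1)) v) =
      sgn (genPar par g) • act par (sym par (.mode g m 1)) (act par (sym par .D) v) +
        act par (sym par (.mode g m 0)) v := by
  have := LinearMap.congr_fun (congrArg (act par) (sym_D_one par g m)) v
  rw [map_add, map_smul, map_mul, map_mul] at this
  exact this

theorem act_D_zero (g) (m : ℤ) (v : Fock par) :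
    act par (sym par .D) (act par (sym par (.mode g m 0)) v) =
      sgn (genPar par g + 1) • act par (sym par (.mode g m 0)) (act par (sym par .D) v) +
        (-(m : ℂ)) • act par (sym par (.mode g (m - 1) 1)) v := by
  have := LinearMap.congr_fun (congrArg (act par) (sym_D_zero par g m)) v
  rw [map_add, map_smul, map_smul, map_mul, map_mul] at this
  exact this

theorem act_mode_vac (g m i) (hm : 0 ≤ m) :
    act par (sym par (.mode g m i)) (ket par 1) = 0 := by
  rw [act_ket, mul_one, ket_eq_zero]
  exact Submodule.subset_span (Or.inl ⟨g, m, i, hm, rfl⟩)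

theorem act_D_vac : act par (sym par .D) (ket par 1) = 0 := by
  rw [act_ket, mul_one, ket_eq_zero]
  exact Submodule.subset_span (Or.inr rfl)

/-- Induction over states, with all modes. -/
theorem mem_of_act (N : Submodule ℂ (Fock par)) (h0 : ket par 1 ∈ N)
    (h : ∀ s, ∀ v ∈ N, act par (sym par s) v ∈ N) (v : Fock par) : v ∈ N := by
  obtain ⟨x, rfl⟩ := ket_surjective par v
  obtain ⟨y, rfl⟩ := RingQuot.mkAlgHom_surjective ℂ (ModeRel par) x
  suffices ∀ v ∈ N, act par (RingQuot.mkAlgHom ℂ (ModeRel par) y) v ∈ N by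
    simpa using this _ h0
  induction y using FreeAlgebra.induction with
  | grade0 r =>
    intro v hv
    rw [AlgHom.commutes, AlgHom.commutes, Module.algebraMap_end_apply]
    exact N.smul_mem r hv
  | grade1 s => exact h s
  | mul a b ha hb =>
    intro v hv
    rw [map_mul, map_mul]
    exact ha _ (hb _ hv)
  | add a b ha hb =>
    intro v hv
    rw [map_add, map_add]
    exact N.add_mem (ha _ hv) (hb _ hv)

/-- Induction over states, with creation operators. -/
theorem mem_of_neg (N : Submodule ℂ (Fock par)) (h0 : ket par 1 ∈ N)
    (h : ∀ g i m, m < 0 → ∀ v ∈ N, act par (sym par (.mode g m i)) v ∈ N) (v : Fock par) :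
    v ∈ N := by
  let Q : Set (Submodule ℂ (Fock par)) := {N | ket par 1 ∈ N ∧
    ∀ g i m, m < 0 → ∀ v ∈ N, act par (sym par (.mode g m i)) v ∈ N}
  have hQ : sInf Q ∈ Q := by
    refine ⟨?_, fun g i m hm v hv => ?_⟩
    · rw [Submodule.mem_sInf]
      exact fun N hN => hN.1
    · rw [Submodule.mem_sInf] at hv ⊢
      exact fun N hN => hN.2 g i m hm v (hv N hN)
  have hmode : ∀ g i m, 0 ≤ m → ∀ v ∈ sInf Q, act par (sym par (.mode g m i)) v ∈ sInf Q := by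
    intro g i m hm
    have h1 : sInf Q ⊓ (sInf Q).comap (act par (sym par (.mode g m i))) ∈ Q := by
      refine ⟨⟨hQ.1, ?_⟩, fun h k n hn v hv => ⟨hQ.2 h k n hn v hv.1, ?_⟩⟩
      · show _ ∈ sInf Q
        rw [act_mode_vac par g m i hm]
        exact Submodule.zero_mem _
      · show _ ∈ sInf Q
        rw [act_comm]
        exact Submodule.add_mem _ (Submodule.smul_mem _ _ (hQ.2 h k n hn _ hv.2))
          (Submodule.smul_mem _ _ hv.1)
    exact fun v hv => (sInf_le h1 hv).2
  have hD : ∀ v ∈ sInf Q, act par (sym par .D) v ∈ sInf Q := by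
    have h1 : sInf Q ⊓ (sInf Q).comap (act par (sym par .D)) ∈ Q := by
      refine ⟨⟨hQ.1, ?_⟩, fun h k n hn v hv => ⟨hQ.2 h k n hn v hv.1, ?_⟩⟩
      · show _ ∈ sInf Q
        rw [act_D_vac]
        exact Submodule.zero_mem _
      · show _ ∈ sInf Q
        rcases GenSystem.zmod2 k with rfl | rfl
        · rw [act_D_zero]
          exact Submodule.add_mem _ (Submodule.smul_mem _ _ (hQ.2 _ _ _ hn _ hv.2))
            (Submodule.smul_mem _ _ (hQ.2 _ _ _ (by omega) _ hv.1))
        · rw [act_D_one]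
          exact Submodule.add_mem _ (Submodule.smul_mem _ _ (hQ.2 _ _ _ hn _ hv.2))
            (hQ.2 _ _ _ hn _ hv.1)
    exact fun v hv => (sInf_le h1 hv).2
  have hall : v ∈ sInf Q := by
    refine mem_of_act par _ hQ.1 (fun s w hw => ?_) v
    cases s with
    | D => exact hD w hw
    | mode g m i =>
      by_cases hm : m < 0
      · exact hQ.2 g i m hm w hw
      · exact hmode g i m (by omega) w hw
  exact (sInf_le (show N ∈ Q from ⟨h0, h⟩)) hall

/-- The superfields of the generators. -/
noncomputable def genField (g : A × Bool) (i : ZMod 2) (m : ℤ) : Module.End ℂ (Fock par) :=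
  act par (sym par (.mode g m i))

theorem genField_isField (g : A × Bool) (i : ZMod 2) : IsField (genField par g i) := by
  intro v
  let N : Submodule ℂ (Fock par) :=
    { carrier := {v | ∃ N : ℤ, ∀ j, N ≤ j → genField par g i j v = 0}
      zero_mem' := ⟨0, fun j _ => map_zero _⟩
      add_mem' := by
        rintro v w ⟨K, hK⟩ ⟨K', hK'⟩
        exact ⟨max K K', fun j hj => by
          rw [map_add, hK j (by omega), hK' j (by omega), add_zero]⟩
      smul_mem' := by
        rintro c v ⟨K, hK⟩
        exact ⟨K, fun j hj => by rw [map_smul, hK j hj, smul_zero]⟩ }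
  refine mem_of_neg par N ⟨0, fun j hj => act_mode_vac par g j i hj⟩ ?_ v
  rintro h k m hm v ⟨K, hK⟩
  refine ⟨max K (-m), fun j hj => ?_⟩
  have := hK j (by omega)
  unfold genField at this ⊢
  rw [act_comm, this, map_zero, smul_zero, if_neg (by omega), zero_smul, add_zero]

theorem genField_local (g h : A × Bool) (i k : ZMod 2) :
    IsLocal (sgn ((genPar par g + i + 1) * (genPar par h + k + 1)))
      (genField par g i) (genField par h k) := by
  refine ⟨1, ?_⟩
  have : scomm (sgn ((genPar par g + i + 1) * (genPar par h + k + 1)))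
      (genField par g i) (genField par h k) =
      fun m n => (if m + n = -1 then pairing par g h i k else 0) • 1 := by
    funext m n
    ext v
    simp only [scomm, genField, LinearMap.sub_apply, LinearMap.smul_apply, Module.End.mul_apply,
      Module.End.one_apply]
    rw [act_comm, add_sub_cancel_left]
  rw [this, pow_one]
  funext m n
  rw [mulSub_apply, show m + 1 + n = m + (n + 1) by ring, sub_self]
  rfl

/-- The generating system of the SUSY charged free fermion vertex algebra. -/
noncomputable def genSystem : GenSystem (Fock par) (A × Bool) where
  vac := ket par 1
  D := act par (sym par .D)
  P := parity par
  par := genPar par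
  x := genField par
  P_P v := by
    obtain ⟨x, rfl⟩ := ket_surjective par v
    rw [parity_ket, parity_ket, parityHom_parityHom]
  P_vac := by rw [parity_ket, map_one]
  P_D v := by
    obtain ⟨x, rfl⟩ := ket_surjective par v
    rw [parity_ket, act_ket, act_ket, parity_ket, map_mul, parityHom_sym, symPar, sgn_one,
      smul_mul_assoc, map_smul]
    module
  P_x g i m v := by
    obtain ⟨x, rfl⟩ := ket_surjective par v
    unfold genField
    rw [parity_ket, act_ket, act_ket, parity_ket, map_mul, parityHom_sym, symPar, smul_mul_assoc,
      map_smul]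
  D_vac := act_D_vac par
  x_vac g i m hm := act_mode_vac par g m i hm
  D_x_one g m := by
    ext v
    simp only [genField, LinearMap.sub_apply, LinearMap.smul_apply, Module.End.mul_apply]
    rw [act_D_one, add_sub_cancel_left]
  D_x_zero g m := by
    ext v
    simp only [genField, LinearMap.sub_apply, LinearMap.smul_apply, Module.End.mul_apply]
    rw [act_D_zero, add_sub_cancel_left]
  x_field := genField_isField par
  x_local := genField_local par
  generates := mem_of_neg par

end ChargedFermion

namespace SUSYVertexAlgebra

variable {V : Type*} [AddCommGroup V] [Module ℂ V] (S : SUSYVertexAlgebra V)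

theorem ext_gr {W : Type*} [AddCommGroup W] [Module ℂ W] {f g : V →ₗ[ℂ] W}
    (h : ∀ p, ∀ v ∈ S.gr p, f v = g v) : f = g := by
  ext v
  have hv : v ∈ ⨆ p, S.gr p := by
    rw [S.gr_internal.submodule_iSup_eq_top]
    trivial
  induction hv using Submodule.iSup_induction' with
  | mem p v hv => exact h p v hv
  | zero => rw [map_zero, map_zero]
  | add v w _ _ hv hw => rw [map_add, map_add, hv, hw]

/-- The parity involution. -/
noncomputable def parity : Module.End ℂ V :=
  DirectSum.toModule ℂ (ZMod 2) V (fun p => sgn p • (S.gr p).subtype) ∘ₗ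
    (LinearEquiv.ofBijective (DirectSum.coeLinearMap S.gr) S.gr_internal).symm.toLinearMap

theorem parity_apply {p : ZMod 2} {v : V} (hv : v ∈ S.gr p) : S.parity v = sgn p • v := by
  have : v = LinearEquiv.ofBijective (DirectSum.coeLinearMap S.gr) S.gr_internal
      (DirectSum.lof ℂ (ZMod 2) (fun p => S.gr p) p ⟨v, hv⟩) := by
    exact (DirectSum.coeLinearMap_lof S.gr p ⟨v, hv⟩).symm
  rw [parity, LinearMap.comp_apply, LinearEquiv.coe_coe]
  conv_lhs => rw [this, LinearEquiv.symm_apply_apply]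
  simp

theorem mem_gr_of_parity {p : ZMod 2} {v : V} (h : S.parity v = sgn p • v) : v ∈ S.gr p := by
  have hv : ∀ v, ∃ v0 ∈ S.gr 0, ∃ v1 ∈ S.gr 1, v = v0 + v1 := by
    intro v
    have hv : v ∈ ⨆ p, S.gr p := by
      rw [S.gr_internal.submodule_iSup_eq_top]
      trivial
    induction hv using Submodule.iSup_induction' with
    | mem p v hv =>
      rcases GenSystem.zmod2 p with rfl | rfl
      · exact ⟨v, hv, 0, Submodule.zero_mem _, (add_zero v).symm⟩
      · exact ⟨0, Submodule.zero_mem _, v, hv, (zero_add v).symm⟩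
    | zero => exact ⟨0, Submodule.zero_mem _, 0, Submodule.zero_mem _, (add_zero 0).symm⟩
    | add v w _ _ hv hw =>
      obtain ⟨v0, h0, v1, h1, rfl⟩ := hv
      obtain ⟨w0, g0, w1, g1, rfl⟩ := hw
      exact ⟨_, Submodule.add_mem _ h0 g0, _, Submodule.add_mem _ h1 g1, by abel⟩
  obtain ⟨v0, h0, v1, h1, rfl⟩ := hv v
  rw [map_add, S.parity_apply h0, S.parity_apply h1, sgn_zero, sgn_one] at h
  rcases GenSystem.zmod2 p with rfl | rfl
  · have : v1 = 0 := by
      rw [sgn_zero] at h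
      linear_combination (norm := module) (-1 / 2 : ℂ) • h
    rwa [this, add_zero]
  · have : v0 = 0 := by
      rw [sgn_one] at h
      linear_combination (norm := module) (1 / 2 : ℂ) • h
    rwa [this, zero_add]

/-- A SUSY vertex algebra is generated by its homogeneous elements. -/
noncomputable def genSystem : GenSystem V (Σ p, S.gr p) where
  vac := S.vac
  D := S.D
  P := S.parity
  par g := g.1
  x g i m := S.mode g.2 m i
  P_P v := by
    have : S.parity ∘ₗ S.parity = LinearMap.id := S.ext_gr fun p v hv => by
      rw [LinearMap.comp_apply, S.parity_apply hv, map_smul, S.parity_apply hv, smul_smul,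
        sgn_mul_self, one_smul, LinearMap.id_apply]
    exact LinearMap.congr_fun this v
  P_vac := by rw [S.parity_apply S.vac_mem, sgn_zero, one_smul]
  P_D v := by
    have : S.parity ∘ₗ S.D = -(S.D ∘ₗ S.parity) := S.ext_gr fun p v hv => by
      rw [LinearMap.comp_apply, S.parity_apply (S.D_mem p v hv), LinearMap.neg_apply,
        LinearMap.comp_apply, S.parity_apply hv, map_smul, sgn_add, sgn_one]
      module
    exact LinearMap.congr_fun this v
  P_x g i m v := by
    have : S.parity ∘ₗ S.mode g.2 m i = sgn (g.1 + i + 1) • (S.mode g.2 m i ∘ₗ S.parity) :=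
      S.ext_gr fun p v hv => by
        rw [LinearMap.comp_apply, S.parity_apply (S.mode_mem _ _ _ g.2.2 v hv m i),
          LinearMap.smul_apply, LinearMap.comp_apply, S.parity_apply hv, map_smul, smul_smul,
          ← sgn_add]
        congr 2
        ring
    exact LinearMap.congr_fun this v
  D_vac := S.D_vac
  x_vac g i m hm := S.mode_vac g.2 m hm i
  D_x_one g m := S.D_mode_one _ _ g.2.2 m
  D_x_zero g m := neg_inj.1 (S.D_mode_zero _ _ g.2.2 m)
  x_field g i v := by
    obtain ⟨N, hN⟩ := S.mode_field g.2 v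
    exact ⟨N, fun j hj => hN j hj i⟩
  x_local g h i k := by
    obtain ⟨N, hN⟩ := S.locality _ _ _ g.2.2 _ h.2.2
    exact ⟨N, hN i k⟩
  generates N h0 h v := by
    have hv : v ∈ ⨆ p, S.gr p := by
      rw [S.gr_internal.submodule_iSup_eq_top]
      trivial
    induction hv using Submodule.iSup_induction' with
    | mem p v hv =>
      have := h ⟨p, v, hv⟩ 1 (-1) (by omega) _ h0
      rwa [S.mode_neg_one_vac] at this
    | zero => exact N.zero_mem
    | add v w _ _ hv hw => exact N.add_mem hv hw

theorem mode_fld {p : ZMod 2} {a : V} (ha : a ∈ S.gr p) (i : ZMod 2) :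
    S.genSystem.Fld (p + i + 1) (fun n => S.mode a n i) :=
  GenSystem.Fld.gen (S := S.genSystem) ⟨p, a, ha⟩ i

theorem mode_one_fld {p : ZMod 2} {a : V} (ha : a ∈ S.gr p) :
    S.genSystem.Fld p (fun n => S.mode a n 1) := by
  have := S.mode_fld ha 1
  rwa [add_assoc, show (1 : ZMod 2) + 1 = 0 from rfl, add_zero] at this

theorem eq_mode {p : ZMod 2} {X : ℤ → Module.End ℂ V} (hX : S.genSystem.Fld p X)
    (ha : X (-1) S.vac ∈ S.gr p) (n : ℤ) : X n = S.mode (X (-1) S.vac) n 1 :=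
  congrFun (hX.ext (S.mode_one_fld ha) (S.mode_neg_one_vac _).symm) n

/-- Homomorphisms of SUSY vertex algebras. -/
structure IsHom {W : Type*} [AddCommGroup W] [Module ℂ W] (S : SUSYVertexAlgebra V)
    (T : SUSYVertexAlgebra W) (f : V →ₗ[ℂ] W) : Prop where
  map_gr : ∀ p, ∀ v ∈ S.gr p, f v ∈ T.gr p
  map_vac : f S.vac = T.vac
  map_D : ∀ v, f (S.D v) = T.D (f v)
  map_mode : ∀ a j i v, f (S.mode a j i v) = T.mode (f a) j i (f v)

end SUSYVertexAlgebra

namespace ChargedFermion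

variable {A : Type*} (par : A → ZMod 2)

/-- The SUSY charged free fermion vertex algebra. -/
noncomputable def fermion : SUSYVertexAlgebra (Fock par) := (genSystem par).toSUSYVertexAlgebra

/-- The generators `φ_a`. -/
noncomputable def phi (a : A) : Fock par := ket par (sym par (.mode (a, false) (-1) 1))

/-- The generators `φ^ā`. -/
noncomputable def phiBar (a : A) : Fock par := ket par (sym par (.mode (a, true) (-1) 1))

open Classical in
/-- A family of vectors with the `Λ`-brackets of the generators. -/
structure IsFermionFamily {W : Type*} [AddCommGroup W] [Module ℂ W] (S : SUSYVertexAlgebra W)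
    (ψ ψBar : A → W) : Prop where
  mem : ∀ a, ψ a ∈ S.gr (par a)
  mem_bar : ∀ a, ψBar a ∈ S.gr (par a + 1)
  bracket : ∀ a b (j : ℕ) i, S.mode (ψ a) j i (ψBar b) =
    if a = b ∧ j = 0 ∧ i = 0 then S.vac else 0
  bracket_phi : ∀ a b (j : ℕ) i, S.mode (ψ a) j i (ψ b) = 0
  bracket_bar : ∀ a b (j : ℕ) i, S.mode (ψBar a) j i (ψBar b) = 0

theorem parity_gen (g : A × Bool) (m : ℤ) (i : ZMod 2) :
    ket par (sym par (.mode g m i)) ∈ (fermion par).gr (genPar par g + i + 1) := by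
  show parity par _ = _
  rw [parity_ket, parityHom_sym, map_smul]
  rfl

theorem mode_gen (g : A × Bool) (n : ℤ) (i : ZMod 2) :
    (fermion par).mode (ket par (sym par (.mode g (-1) 1))) n i =
      act par (sym par (.mode g n i)) := by
  have h1 : ket par (sym par (.mode g (-1) 1)) ∈ (genSystem par).grade (genPar par g + 1 + 1) :=
    parity_gen par g (-1) 1
  obtain ⟨X, hX, hv, e1, e0⟩ := (genSystem par).exists_field h1
  have hg := GenSystem.Fld.gen (S := genSystem par) g 1
  have hXg : X = genField par g 1 := hX.ext hg (by
    rw [hv]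
    change _ = act par _ (ket par 1)
    rw [act_ket, mul_one])
  rcases GenSystem.zmod2 i with rfl | rfl
  · refine (e0 n).trans ?_
    rw [hXg]
    exact congrFun (GenSystem.adD_x_one (S := genSystem par) g) n
  · refine (e1 n).trans ?_
    rw [hXg]
    rfl

theorem isFermionFamily : IsFermionFamily par (fermion par) (phi par) (phiBar par) := by
  classical
  have hp : ∀ p : ZMod 2, p + 1 + 1 = p := by decide
  have key : ∀ (g h : A × Bool) (j : ℕ) i, (fermion par).mode (ket par (sym par (.mode g (-1) 1)))
      j i (ket par (sym par (.mode h (-1) 1))) =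
      (if j = 0 then pairing par g h i 1 else 0) • (fermion par).vac := by
    intro g h j i
    rw [mode_gen, show ket par (sym par (.mode h (-1) 1)) =
      act par (sym par (.mode h (-1) 1)) (ket par 1) by rw [act_ket, mul_one], act_comm,
      act_mode_vac par g j i (by omega), map_zero, smul_zero, zero_add]
    congr 1
    by_cases hj : j = 0
    · subst hj; simp
    · rw [if_neg hj, if_neg (by omega)]
  refine ⟨fun a => ?_, fun a => ?_, fun a b j i => ?_, fun a b j i => ?_, fun a b j i => ?_⟩
  · have := parity_gen par (a, false) (-1) 1
    rwa [hp] at this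
  · have := parity_gen par (a, true) (-1) 1
    rwa [hp] at this
  · refine (key (a, false) (b, true) j i).trans ?_
    by_cases hab : a = b
    · subst hab
      rcases GenSystem.zmod2 i with rfl | rfl <;> by_cases hj : j = 0 <;> simp [pairing, hj]
    · simp [pairing, hab, Ne.symm hab]
  · exact (key (a, false) (b, false) j i).trans (by simp [pairing])
  · exact (key (a, true) (b, true) j i).trans (by simp [pairing])

section universal

variable {par} {W : Type*} [AddCommGroup W] [Module ℂ W] {S : SUSYVertexAlgebra W}
  {ψ ψBar : A → W}

/-- The two families as one. -/
def fam (ψ ψBar : A → W) (g : A × Bool) : W := if g.2 then ψBar g.1 else ψ g.1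

theorem IsFermionFamily.fam_mem (h : IsFermionFamily par S ψ ψBar) (g : A × Bool) :
    fam ψ ψBar g ∈ S.gr (genPar par g) := by
  obtain ⟨a, f⟩ := g
  cases f
  · exact h.mem a
  · exact h.mem_bar a

theorem mode_D {p : ZMod 2} {a b : W} (ha : a ∈ S.gr p) (j : ℤ) :
    S.mode a j 1 (S.D b) = sgn p • (S.D (S.mode a j 1 b) - S.mode a j 0 b) ∧
    S.mode a j 0 (S.D b) = sgn (p + 1) • (S.D (S.mode a j 0 b) + (j : ℂ) • S.mode a (j - 1) 1 b)
      := by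
  have h1 := LinearMap.congr_fun (S.D_mode_one p a ha j) b
  have h0 := LinearMap.congr_fun (neg_inj.1 (S.D_mode_zero p a ha j)) b
  simp only [LinearMap.sub_apply, LinearMap.smul_apply, Module.End.mul_apply] at h1 h0
  constructor
  · rw [← h1, sub_sub_cancel, smul_smul, sgn_mul_self, one_smul]
  · rw [show (j : ℂ) • S.mode a (j - 1) 1 b = -((-(j : ℂ)) • S.mode a (j - 1) 1 b) by module,
      ← h0, neg_sub, add_sub_cancel, smul_smul, sgn_mul_self, one_smul]

theorem IsFermionFamily.comm_aux (h : IsFermionFamily par S ψ ψBar) (g k : A × Bool)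
    (hgk : ¬ (g.2 = true ∧ k.2 = false)) (m n : ℤ) (i l : ZMod 2) :
    scomm (sgn ((genPar par g + i + 1) * (genPar par k + l + 1)))
      (fun m => S.mode (fam ψ ψBar g) m i) (fun n => S.mode (fam ψ ψBar k) n l) m n =
      (if m + n = -1 then pairing par g k i l else 0) • 1 := by
  classical
  have hb : ∀ (j : ℕ) i, S.mode (fam ψ ψBar g) j i (fam ψ ψBar k) =
      if j = 0 then pairing par g k i 1 • S.vac else 0 := by
    intro j i
    obtain ⟨a, f⟩ := g
    obtain ⟨b, f'⟩ := k
    cases f <;> cases f'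
    · exact (h.bracket_phi a b j i).trans (by simp [pairing])
    · refine (h.bracket a b j i).trans ?_
      by_cases hab : a = b
      · subst hab
        rcases GenSystem.zmod2 i with rfl | rfl <;> by_cases hj : j = 0 <;> simp [pairing, hj]
      · simp [pairing, hab, Ne.symm hab]
    · simp at hgk
    · exact (h.bracket_bar a b j i).trans (by simp [pairing])
  refine GenSystem.Fld.scomm_eq (S.mode_fld (h.fam_mem g) i) (S.mode_fld (h.fam_mem k) l)
    (pairing par g k i l) ?_ ?_ m n
  · exact pairing_parity par g k i l
  · intro j
    have p11 : pairing par g k 1 1 = 0 := by simp [pairing]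
    have p00 : pairing par g k 0 0 = 0 := by simp [pairing]
    have p10 : pairing par g k 1 0 = -sgn (genPar par g) * pairing par g k 0 1 := by
      unfold pairing
      by_cases hc : k.1 = g.1 ∧ k.2 ≠ g.2
      · rw [if_pos hc, if_pos hc]
        simp
      · rw [if_neg hc, if_neg hc, mul_zero]
    rcases GenSystem.zmod2 l with rfl | rfl
    · have e : S.mode (fam ψ ψBar k) (-1) 0 S.vac = S.D (fam ψ ψBar k) := by
        rw [← S.D_mode_one _ _ (h.fam_mem k)]
        simp [S.D_vac, S.mode_neg_one_vac]
      change S.mode _ _ _ (S.mode _ _ _ S.vac) = if j = 0 then _ • S.vac else 0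
      rw [e]
      have hD := mode_D (S := S) (b := fam ψ ψBar k) (h.fam_mem g) j
      rcases GenSystem.zmod2 i with rfl | rfl
      · rw [hD.2, hb, p00]
        rcases j with _ | j
        · simp [S.D_vac]
        · rw [if_neg (Nat.succ_ne_zero j), if_neg (Nat.succ_ne_zero j), Nat.cast_succ,
            add_sub_cancel_right, hb, p11]
          simp
      · rw [hD.1, hb, hb, p11, p10]
        split_ifs
        · rw [zero_smul, map_zero]
          module
        · simp
    · change S.mode _ _ _ (S.mode _ _ _ S.vac) = _
      rw [S.mode_neg_one_vac, hb]
      rfl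

theorem pairing_swap (g k : A × Bool) (i l : ZMod 2) : pairing par g k i l =
    -sgn ((genPar par g + i + 1) * (genPar par k + l + 1)) * pairing par k g l i := by
  by_cases h : k.1 = g.1 ∧ k.2 ≠ g.2
  · have hk := genPar_of_ne par h.1 h.2
    have h' : g.1 = k.1 ∧ g.2 ≠ k.2 := ⟨h.1.symm, h.2.symm⟩
    unfold pairing
    rw [if_pos h, if_pos h', hk]
    generalize genPar par g = q
    have h01 : ∀ q : ZMod 2, (q + 0 + 1) * (q + 1 + 1 + 1) = q + 1 := by decide
    have h10 : ∀ q : ZMod 2, (q + 1 + 1) * (q + 1 + 0 + 1) = q := by decide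
    rcases GenSystem.zmod2 i with rfl | rfl <;> rcases GenSystem.zmod2 l with rfl | rfl
    · simp
    · rw [h01, sgn_add, sgn_one]
      simp [sgn_mul_self]
    · rw [h10]
      simp
    · simp
  · have h' : ¬ (g.1 = k.1 ∧ g.2 ≠ k.2) := fun h' => h ⟨h'.1.symm, h'.2.symm⟩
    unfold pairing
    rw [if_neg h, if_neg h', mul_zero]

theorem IsFermionFamily.comm (h : IsFermionFamily par S ψ ψBar) (g k : A × Bool)
    (m n : ℤ) (i l : ZMod 2) :
    S.mode (fam ψ ψBar g) m i * S.mode (fam ψ ψBar k) n l =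
      sgn ((genPar par g + i + 1) * (genPar par k + l + 1)) •
        (S.mode (fam ψ ψBar k) n l * S.mode (fam ψ ψBar g) m i) +
      (if m + n = -1 then pairing par g k i l else 0) • 1 := by
  by_cases hgk : g.2 = true ∧ k.2 = false
  · have := h.comm_aux k g (by rintro ⟨h1, h2⟩; simp_all) n m l i
    unfold scomm at this
    rw [pairing_swap, mul_comm (genPar par g + i + 1), add_comm m n]
    rw [sub_eq_iff_eq_add] at this
    dsimp only at this
    have hs := sgn_mul_self ((genPar par k + l + 1) * (genPar par g + i + 1))
    generalize sgn ((genPar par k + l + 1) * (genPar par g + i + 1)) = s at *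
    rw [this, smul_add, smul_smul _ _ (S.mode (fam ψ ψBar g) m i * _), hs, one_smul]
    split_ifs <;> module
  · have := h.comm_aux g k hgk m n i l
    unfold scomm at this
    rw [← this]
    abel

/-- The action of the algebra of modes on a SUSY vertex algebra with a family of vectors with the
`Λ`-brackets of the generators. -/
noncomputable def IsFermionFamily.actHom (h : IsFermionFamily par S ψ ψBar) :
    ModeAlg par →ₐ[ℂ] Module.End ℂ W :=
  RingQuot.liftAlgHom ℂ ⟨FreeAlgebra.lift ℂ fun s => match s with
    | .mode g m i => S.mode (fam ψ ψBar g) m i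
    | .D => S.D, by
    intro x y hxy
    induction hxy with
    | comm g k m n i l =>
      simp only [map_mul, map_add, map_smul, FreeAlgebra.lift_ι_apply, AlgHom.commutes]
      rw [h.comm g k m n i l, Algebra.algebraMap_eq_smul_one]
    | D_one g m =>
      simp only [map_mul, map_add, map_smul, FreeAlgebra.lift_ι_apply]
      rw [← S.D_mode_one _ _ (h.fam_mem g), add_sub_cancel]
    | D_zero g m =>
      simp only [map_mul, map_add, map_smul, FreeAlgebra.lift_ι_apply]
      rw [← neg_inj.1 (S.D_mode_zero _ _ (h.fam_mem g) m), add_sub_cancel]⟩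

theorem IsFermionFamily.actHom_mode (h : IsFermionFamily par S ψ ψBar) (g m i) :
    h.actHom (sym par (.mode g m i)) = S.mode (fam ψ ψBar g) m i := by
  simp [actHom, sym]

theorem IsFermionFamily.actHom_D (h : IsFermionFamily par S ψ ψBar) :
    h.actHom (sym par .D) = S.D := by
  simp [actHom, sym]

/-- The homomorphism given by a family of vectors with the `Λ`-brackets of the generators. -/
noncomputable def IsFermionFamily.lift (h : IsFermionFamily par S ψ ψBar) : Fock par →ₗ[ℂ] W :=
  Submodule.liftQ ((annihilator par).restrictScalars ℂ)
    ((LinearMap.applyₗ S.vac : Module.End ℂ W →ₗ[ℂ] W) ∘ₗ h.actHom.toLinearMap) (by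
      intro x hx
      change x ∈ annihilator par at hx
      rw [LinearMap.mem_ker]
      change h.actHom x S.vac = 0
      induction hx using Submodule.span_induction with
      | mem x hx =>
        rcases hx with ⟨g, m, i, hm, rfl⟩ | rfl
        · rw [h.actHom_mode, S.mode_vac _ _ hm]
        · rw [h.actHom_D, S.D_vac]
      | zero => simp
      | add x y _ _ hx hy => rw [map_add, LinearMap.add_apply, hx, hy, add_zero]
      | smul a x _ hx => rw [smul_eq_mul, map_mul, Module.End.mul_apply, hx, map_zero])

theorem IsFermionFamily.lift_ket (h : IsFermionFamily par S ψ ψBar) (x : ModeAlg par) :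
    h.lift (ket par x) = h.actHom x S.vac := rfl

theorem IsFermionFamily.lift_act (h : IsFermionFamily par S ψ ψBar) (x : ModeAlg par)
    (v : Fock par) : h.lift (act par x v) = h.actHom x (h.lift v) := by
  obtain ⟨y, rfl⟩ := ket_surjective par v
  rw [act_ket, lift_ket, lift_ket, map_mul, Module.End.mul_apply]

theorem IsFermionFamily.lift_gen (h : IsFermionFamily par S ψ ψBar) (g : A × Bool) :
    h.lift (ket par (sym par (.mode g (-1) 1))) = fam ψ ψBar g := by
  rw [lift_ket, actHom_mode, S.mode_neg_one_vac]

theorem IsFermionFamily.lift_fld (h : IsFermionFamily par S ψ ψBar) {p : ZMod 2}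
    {X : ℤ → Module.End ℂ (Fock par)} (hX : (genSystem par).Fld p X) :
    ∃ X', S.genSystem.Fld p X' ∧ ∀ n v, h.lift (X n v) = X' n (h.lift v) := by
  induction hX with
  | zero p => exact ⟨0, .zero p, fun n v => by simp⟩
  | add _ _ hX hY =>
    obtain ⟨X', hX, eX⟩ := hX
    obtain ⟨Y', hY, eY⟩ := hY
    exact ⟨_, hX.add hY, fun n v => by simp [eX, eY]⟩
  | smul c _ hX =>
    obtain ⟨X', hX, eX⟩ := hX
    exact ⟨_, hX.smul c, fun n v => by simp [eX]⟩
  | one =>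
    refine ⟨_, .one, fun n v => ?_⟩
    simp only [idField]
    split_ifs <;> simp
  | gen g i =>
    refine ⟨_, S.mode_fld (h.fam_mem g) i, fun n v => ?_⟩
    rw [← h.actHom_mode, ← h.lift_act]
    rfl
  | deriv _ hX =>
    obtain ⟨X', hX, eX⟩ := hX
    exact ⟨_, hX.deriv, fun n v => by simp [deriv, eX]⟩
  | adD _ hX =>
    obtain ⟨X', hX, eX⟩ := hX
    have hD : ∀ v, h.lift ((genSystem par).D v) = S.genSystem.D (h.lift v) := fun v => by
      refine (h.lift_act _ v).trans ?_
      rw [h.actHom_D]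
      rfl
    exact ⟨_, hX.adD, fun n v => by simp [adD, eX, hD]⟩
  | @nop p q X Y fX fY _ _ _ hX hY =>
    obtain ⟨X', hX, eX⟩ := hX
    obtain ⟨Y', hY, eY⟩ := hY
    refine ⟨_, hX.nop hX.field hY.field hY (hX.isLocal hY), fun n v => ?_⟩
    simp only [nop_apply]
    have e1 := h.lift.toAddMonoidHom.map_finsum (nopTerm_finite (sgn (p * q)) fX fY n v)
    simp only [LinearMap.toAddMonoidHom_coe] at e1
    rw [e1]
    congr 1
    funext j
    simp only [nopTerm]
    split_ifs
    · rw [eX, eY]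
    · rw [map_smul, eY, eX]

theorem IsFermionFamily.lift_isHom (h : IsFermionFamily par S ψ ψBar) :
    SUSYVertexAlgebra.IsHom (fermion par) S h.lift := by
  have hvac : h.lift (fermion par).vac = S.vac := by
    refine (h.lift_ket 1).trans ?_
    rw [map_one, Module.End.one_apply]
  have hD : ∀ v, h.lift ((fermion par).D v) = S.D (h.lift v) := fun v => by
    refine (h.lift_act _ v).trans ?_
    rw [h.actHom_D]
  have key : ∀ p, ∀ a ∈ (fermion par).gr p, h.lift a ∈ S.gr p ∧
      ∀ n v, h.lift ((fermion par).mode a n 1 v) = S.mode (h.lift a) n 1 (h.lift v) := by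
    intro p a ha
    obtain ⟨X, hX, hv, e1, -⟩ := (genSystem par).exists_field ha
    obtain ⟨X', hX', eX⟩ := h.lift_fld hX
    have e2 : X' (-1) S.vac = h.lift a := by
      rw [← hvac, ← eX]
      exact congrArg h.lift hv
    have hmem : h.lift a ∈ S.gr p := by
      refine S.mem_gr_of_parity ?_
      have e3 := hX'.parity (-1) S.vac
      rw [e2] at e3
      refine e3.trans ?_
      change sgn p • X' (-1) (S.parity S.vac) = _
      rw [S.parity_apply S.vac_mem, sgn_zero, one_smul, e2]
    refine ⟨hmem, fun n v => ?_⟩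
    rw [← e2] at hmem ⊢
    rw [← S.eq_mode hX' hmem, ← eX, ← e1]
    rfl
  refine ⟨fun p v hv => (key p v hv).1, hvac, hD, fun a j i v => ?_⟩
  suffices hs : h.lift ∘ₗ ((LinearMap.applyₗ v : Module.End ℂ (Fock par) →ₗ[ℂ] Fock par) ∘ₗ
      (LinearMap.proj i ∘ₗ LinearMap.proj j ∘ₗ (fermion par).mode)) =
      ((LinearMap.applyₗ (h.lift v) : Module.End ℂ W →ₗ[ℂ] W) ∘ₗ
      (LinearMap.proj i ∘ₗ LinearMap.proj j ∘ₗ S.mode)) ∘ₗ h.lift from LinearMap.congr_fun hs a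
  refine (fermion par).ext_gr fun p a ha => ?_
  show h.lift ((fermion par).mode a j i v) = S.mode (h.lift a) j i (h.lift v)
  obtain ⟨hmem, h1⟩ := key p a ha
  rcases GenSystem.zmod2 i with rfl | rfl
  · rw [← (fermion par).D_mode_one p a ha, ← S.D_mode_one p _ hmem]
    simp [h1, hD]
  · exact h1 j v

/-- The universal property of the SUSY charged free fermion vertex algebra: it is the universal
enveloping SUSY vertex algebra of the free `ℂ[∂, D]`-module on `φ_a`, `φ^ā` with
`[φ_a _Λ φ^b̄] = δ_ab`, `[φ_a _Λ φ_b] = [φ^ā _Λ φ^b̄] = 0`. -/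
theorem existsUnique_hom (h : IsFermionFamily par S ψ ψBar) :
    ∃! f : Fock par →ₗ[ℂ] W, SUSYVertexAlgebra.IsHom (fermion par) S f ∧
      (∀ a, f (phi par a) = ψ a) ∧ ∀ a, f (phiBar par a) = ψBar a := by
  refine ⟨h.lift, ⟨h.lift_isHom, fun a => h.lift_gen (a, false), fun a => h.lift_gen (a, true)⟩,
    ?_⟩
  rintro f ⟨hf, h1, h2⟩
  have hfam : ∀ g, f (ket par (sym par (.mode g (-1) 1))) = fam ψ ψBar g := by
    rintro ⟨a, b⟩
    cases b
    exacts [h1 a, h2 a]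
  ext v
  refine mem_of_act par (LinearMap.eqLocus f h.lift) ?_ (fun s w hw => ?_) v
  · exact hf.map_vac.trans h.lift_isHom.map_vac.symm
  · rw [LinearMap.mem_eqLocus] at *
    cases s with
    | D => exact (hf.map_D w).trans (by rw [hw]; exact (h.lift_isHom.map_D w).symm)
    | mode g m i =>
      rw [← mode_gen, hf.map_mode, h.lift_isHom.map_mode, hw, hfam, h.lift_gen]

end universal

end ChargedFermion

/-- The normally ordered product `:ab: = a_(-1|1) b`. -/
def SUSYVertexAlgebra.nprod {V : Type*} [AddCommGroup V] [Module ℂ V]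
    (S : SUSYVertexAlgebra V) (a b : V) : V := S.mode a (-1) 1 b

namespace ChargedFermion

variable {A : Type*} [Fintype A] (par : A → ZMod 2)

/-- The standard current
`∑_{a even} :(Dφ_a) φ^ā: + ∑_{a odd} :(Dφ^ā) φ_a:`. -/
noncomputable def currentSt : Fock par :=
  ∑ a, if par a = 0 then
    (fermion par).nprod ((fermion par).D (phi par a)) (phiBar par a)
  else
    (fermion par).nprod ((fermion par).D (phiBar par a)) (phi par a)

/-- The ghost current
`∑_{a even} t_a (:(Dφ_a) φ^ā: + :φ_a (Dφ^ā):) + ∑_{a odd} t_a (:(Dφ^ā) φ_a: + :φ^ā (Dφ_a):)`. -/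
noncomputable def currentGhost (t : A → ℂ) : Fock par :=
  ∑ a, if par a = 0 then
    t a • ((fermion par).nprod ((fermion par).D (phi par a)) (phiBar par a) +
      (fermion par).nprod (phi par a) ((fermion par).D (phiBar par a)))
  else
    t a • ((fermion par).nprod ((fermion par).D (phiBar par a)) (phi par a) +
      (fermion par).nprod (phiBar par a) ((fermion par).D (phi par a)))

/-- The shifted current. -/
noncomputable def currentSh (t : A → ℂ) : Fock par := currentSt par + currentGhost par t

/-- The charge operator: the coefficient `(0|1)` of the superfield of the shifted current. -/
noncomputable def chargeOp (t : A → ℂ) : Module.End ℂ (Fock par) :=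
  (fermion par).mode (currentSh par t) 0 1

/-- The subspace of vectors of charge `m`: the eigenspace of the charge operator with
eigenvalue `m`. -/
noncomputable def chargeSpace (t : A → ℂ) (m : ℂ) : Submodule ℂ (Fock par) :=
  Module.End.eigenspace (chargeOp par t) m

end ChargedFermion

end SUSYVA

namespace SUSYVA

namespace ChargedFermion

variable {A : Type*} (par : A → ZMod 2)

/-! The charge operator is diagonalizable with integral eigenvalues because the space of states is
built from the vacuum by operators that each shift the charge by a fixed integer. The vacuum has
charge zero, since every nonnegative mode annihilates it. If `T` is the charge operator and every
mode `Z_r` of a component of a generator satisfies `[T, Z_r] = c Z_r` with `c` an integer, then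
`Z_r` sends charge `k` to charge `k + c`. The sum of the integral eigenspaces then contains the
vacuum and is stable under all creation operators, so it is the whole space (`iSup_chargeSpace`,
through the induction principle `mem_of_neg`). Directness of the sum is the independence of
eigenspaces for distinct eigenvalues. No monomial basis of the space of states is needed; cyclicity
over the vacuum suffices.

The content is therefore the commutator formula, recorded as `HasIntegralCharges`. The current is an
integral combination of states `:XY:`, where `X` is one component of a generator and `Y` is the
complementary component of the conjugate generator; the derivatives `Dφ` only exchange the two
components (`D_ket`). By uniqueness of the field attached to a state, the `θ = 0` part of the
superfield of such a state is the normally ordered product of the two component fields (`mode_ket`,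
`mode_nprod`).

The commutator of the zero mode of `:XY:` with a mode `Z_r` of a third component is a Wick
computation with single contractions only (`nop_hasIntegralCharges`). Contracting `Z` with `Y`
leaves `X_r`, and contracting `Z` with `X` leaves `Y_r`, up to constants. Components pair only with
their duals (`pairing_eq_zero`), so the first contraction is nonzero only for `Z = X` and the second
only for `Z = Y`; in every case a multiple of `Z_r` itself remains. The constants are contractions
normalized to `0` or `±1` (`exists_int_pairing`), and the shifts `t_a` are integers, so all charges
are integral. -/

/-! ### Duality and integrality of the contractions between generators -/

/-- The conjugate generator: `φ_a` and `φ^ā` are exchanged. -/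
def conj (g : A × Bool) : A × Bool := (g.1, !g.2)

theorem conj_conj (g : A × Bool) : conj (conj g) = g := by simp [conj]

/-- The bracket `δ_ab` couples `φ_a` only to `φ^ā`, and it contributes only between one
`θ`-component and the other. Hence each component of a generator has exactly one possible partner,
which is what makes the components eigenvectors for the charge. -/
theorem pairing_eq_zero {g h : A × Bool} {i k : ZMod 2} (hne : ¬ (h = conj g ∧ k = i + 1)) :
    pairing par g h i k = 0 := by
  obtain ⟨a, f⟩ := g
  obtain ⟨b, f'⟩ := h
  unfold pairing
  by_cases hc : b = a ∧ f' ≠ f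
  · obtain ⟨rfl, hf⟩ := hc
    have hk : k ≠ i + 1 := fun hk => hne ⟨by simp [conj, Bool.eq_not_of_ne hf], hk⟩
    -- The two nonzero values occur at `(i, k) = (0, 1)` and `(1, 0)`, and in both cases `k = i + 1`
    -- holds modulo 2.
    split_ifs with h1 h2 h3
    · exact absurd h2 (by rintro ⟨rfl, rfl⟩; exact hk rfl)
    · exact absurd h3 (by rintro ⟨rfl, rfl⟩; exact hk rfl)
    all_goals rfl
  · exact if_neg hc

theorem exists_int_sgn (p : ZMod 2) : ∃ c : ℤ, sgn p = c := by
  unfold sgn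
  split_ifs
  exacts [⟨1, by simp⟩, ⟨-1, by simp⟩]

/-- The source of integrality: the brackets are normalized to `δ_ab`, so every contraction is `0`,
`1` or a sign. -/
theorem exists_int_pairing (g h : A × Bool) (i k : ZMod 2) :
    ∃ c : ℤ, pairing par g h i k = c := by
  obtain ⟨c, hc⟩ := exists_int_sgn (genPar par g)
  unfold pairing
  split_ifs
  exacts [⟨1, by simp⟩, ⟨-c, by simp [hc]⟩, ⟨0, by simp⟩, ⟨0, by simp⟩]

/-! ### Fields attached to the generators and to their normally ordered products -/

/-- The `(n|1)`-coefficients of the superfield of the state `g_(-1|i)|0⟩`. -/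
theorem mode_ket (g : A × Bool) (i : ZMod 2) (n : ℤ) :
    (fermion par).mode (ket par (sym par (.mode g (-1) i))) n 1 = genField par g i n := by
  obtain ⟨X, hX, hv, e1, -⟩ := (genSystem par).exists_field (parity_gen par g (-1) i)
  refine (e1 n).trans ?_
  -- Goddard uniqueness: two generated fields of the same parity that create the same vector from
  -- the vacuum coincide. It remains to see that the component `i` of the generator creates
  -- `g_(-1|i)|0⟩`. This covers `i = 0` as well, where the component becomes the leading coefficient
  -- of the superfield of another state.
  rw [hX.ext (GenSystem.Fld.gen (S := genSystem par) g i)]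
  · rfl
  · rw [hv]
    change _ = act par _ (ket par 1)
    rw [act_ket, mul_one]

/-- The state `:g_(-1|i) h_(-1|k):`, whose superfield has a normally ordered product as its
component `θ = 0`. -/
theorem mode_nprod (g h : A × Bool) (i k : ZMod 2) (n : ℤ) :
    (fermion par).mode ((fermion par).nprod (ket par (sym par (.mode g (-1) i)))
      (ket par (sym par (.mode h (-1) k)))) n 1 =
    nop (sgn ((genPar par g + i + 1) * (genPar par h + k + 1))) (genField par g i)
      (genField par h k) (genField_isField par g i) (genField_isField par h k) n := by
  have hX := GenSystem.Fld.gen (S := genSystem par) g i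
  have hY := GenSystem.Fld.gen (S := genSystem par) h k
  -- At index `-1` on the vacuum all summands of the normally ordered product vanish except `X_(-1)
  -- Y_(-1)|0⟩`, which is the state in question.
  have hv := GenSystem.nop_neg_one_vac hX hY
  have hXY := hX.nop hX.field hY.field hY (hX.isLocal hY)
  have hs : (fermion par).nprod (ket par (sym par (.mode g (-1) i)))
      (ket par (sym par (.mode h (-1) k))) = genField par g i (-1)
        (genField par h k (-1) (ket par 1)) := by
    unfold SUSYVertexAlgebra.nprod
    rw [mode_ket]
    unfold genField
    rw [act_ket _ _ 1, mul_one]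
  -- Fields are attached to homogeneous states only, so the parity of the product state is needed.
  -- It is read off from the parity of the field that creates it, the vacuum being even.
  have hmem : (fermion par).nprod (ket par (sym par (.mode g (-1) i)))
      (ket par (sym par (.mode h (-1) k))) ∈
      (genSystem par).grade (genPar par g + i + 1 + (genPar par h + k + 1)) := by
    rw [hs, GenSystem.mem_grade]
    refine (congrArg (genSystem par).P hv.symm).trans ((hXY.parity (-1) _).trans ?_)
    rw [(genSystem par).P_vac]
    exact congrArg _ hv
  obtain ⟨X, hX', hv', e1, -⟩ := (genSystem par).exists_field hmem
  refine (e1 n).trans ?_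
  -- Uniqueness again: the field of the state and the normally ordered product have the same parity
  -- and create the same vector.
  rw [hX'.ext hXY (hv'.trans (hs.trans hv.symm))]
  rfl

/-! ### Operators with integral charges -/

/-- All modes of the generators are eigenvectors of the commutator with `T`, with integral
eigenvalues that do not depend on the index of the mode. -/
def HasIntegralCharges (T : Module.End ℂ (Fock par)) : Prop :=
  ∀ g i, ∃ c : ℤ, ∀ m v, T (genField par g i m v) =
    genField par g i m (T v) + (c : ℂ) • genField par g i m v

variable {par}

theorem HasIntegralCharges.zero : HasIntegralCharges par 0 := fun _ _ => ⟨0, by simp⟩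

theorem HasIntegralCharges.add {T T' : Module.End ℂ (Fock par)} (h : HasIntegralCharges par T)
    (h' : HasIntegralCharges par T') : HasIntegralCharges par (T + T') := fun g i => by
  obtain ⟨c, hc⟩ := h g i
  obtain ⟨c', hc'⟩ := h' g i
  refine ⟨c + c', fun m v => ?_⟩
  simp only [LinearMap.add_apply, hc, hc', map_add]
  push_cast
  module

/-- The place where integrality of the shifts `t_a` enters: scaling an operator scales its charges,
and only an integral factor keeps them integral. -/
theorem HasIntegralCharges.int_smul {T : Module.End ℂ (Fock par)}
    (h : HasIntegralCharges par T) (t : ℤ) : HasIntegralCharges par ((t : ℂ) • T) := fun g i => by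
  obtain ⟨c, hc⟩ := h g i
  refine ⟨t * c, fun m v => ?_⟩
  simp only [LinearMap.smul_apply, hc, map_smul]
  push_cast
  module

variable (par)

/-! ### Commutator of the zero mode of a normally ordered product with a mode of a generator -/

/-- The charges of the zero mode of the normally ordered product of a component of a generator and
the component dual to it. -/
theorem nop_hasIntegralCharges (g : A × Bool) (i : ZMod 2) :
    HasIntegralCharges par (nop (sgn ((genPar par g + i + 1) *
      (genPar par (conj g) + (i + 1) + 1))) (genField par g i) (genField par (conj g) (i + 1))
      (genField_isField par g i) (genField_isField par (conj g) (i + 1)) 0) := by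
  intro l j
  obtain ⟨c₁, hc₁⟩ := exists_int_pairing par (conj g) l (i + 1) j
  obtain ⟨c₂, hc₂⟩ := exists_int_pairing par g l i j
  obtain ⟨s, hs⟩ := exists_int_sgn ((genPar par g + i + 1) * (genPar par (conj g) + (i + 1) + 1))
  -- With `Z` the component `(l, j)`, `c₁` is the contraction of `Z` with the second factor, `c₂`
  -- the contraction with the first factor, and `s` the sign of exchanging the two factors. At most
  -- one of `c₁`, `c₂` is nonzero, since the first requires `l = g` and the second `l = conj g`.
  refine ⟨c₁ + s * c₂, fun r v => ?_⟩
  push_cast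
  rw [← hc₁, ← hc₂, ← hs]
  have hii : i + 1 + 1 = i := (by decide : ∀ i : ZMod 2, i + 1 + 1 = i) i
  have hX := genField_isField par g i
  have hY := genField_isField par (conj g) (i + 1)
  have cX := fun m w => act_comm par g l m r i j w
  have cY := fun m w => act_comm par (conj g) l m r (i + 1) j w
  change ∀ m w, genField par g i m (genField par l j r w) =
    _ • genField par l j r (genField par g i m w) + _ at cX
  change ∀ m w, genField par (conj g) (i + 1) m (genField par l j r w) =
    _ • genField par l j r (genField par (conj g) (i + 1) m w) + _ at cY
  -- A nonzero contraction of `Z` with one factor identifies `Z` with the other factor. For `pY`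
  -- this uses that conjugating twice and shifting the component index twice are both trivial.
  have pX : pairing par g l i j = 0 ∨ (l = conj g ∧ j = i + 1) :=
    or_iff_not_imp_right.2 (pairing_eq_zero par)
  have pY : pairing par (conj g) l (i + 1) j = 0 ∨ (l = g ∧ j = i) := by
    have := or_iff_not_imp_right.2 (pairing_eq_zero par (g := conj g) (h := l) (i := i + 1)
      (k := j))
    rwa [conj_conj, hii] at this
  -- Conjugation and the change of component each flip the parity, so the two factors have the same
  -- parity `p`. The product is then even, and its zero mode has an ordinary commutator with `Z_r`,
  -- without sign.
  have hpar : genPar par (conj g) + (i + 1) + 1 = genPar par g + i + 1 := by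
    rw [genPar_of_ne par (g := g) (h := conj g) rfl (by simp [conj])]
    exact (by decide : ∀ q i : ZMod 2, q + 1 + (i + 1) + 1 = q + i + 1) _ i
  rw [hpar] at cY ⊢
  set p := genPar par g + i + 1
  set X := genField par g i
  set Y := genField par (conj g) (i + 1)
  set Z := genField par l j
  set q := genPar par l + j + 1 with hq
  set β := pairing par (conj g) l (i + 1) j
  set α := pairing par g l i j
  have hpq : sgn (p * q) * sgn (p * q) = 1 := sgn_mul_self _
  -- This turns the Wick formula into an eigenvector equation: contracting away `Y` leaves `β X`,
  -- and either `β` vanishes or `Z` is `X`. The same holds for `α Y` in `hα`.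
  have hβ : ∀ n w, β • X n w = β • Z n w := by
    rcases pY with h | ⟨rfl, rfl⟩
    · intro n w; rw [h, zero_smul, zero_smul]
    · intro n w; rfl
  have hα : ∀ n w, α • Y n w = α • Z n w := by
    rcases pX with h | ⟨rfl, rfl⟩
    · intro n w; rw [h, zero_smul, zero_smul]
    · intro n w; rfl
  -- When a contraction is nonzero, `Z` is one of the two factors and so has their common parity, `q
  -- = p`. In front of a contraction the sign of passing `Z` may thus be replaced by the sign `sgn
  -- (p * p)` of exchanging the factors.
  have sβ : sgn (p * q) * β = sgn (p * p) * β := by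
    rcases pY with h | ⟨rfl, rfl⟩
    · rw [h, mul_zero, mul_zero]
    · rfl
  have sα : sgn (p * q) * α = sgn (p * p) * α := by
    rcases pX with h | ⟨rfl, rfl⟩
    · rw [h, mul_zero, mul_zero]
    · rw [hq, hpar]
  have hε : sgn (p * p) * sgn (p * p) = 1 := sgn_mul_self _
  rw [nop_apply, nop_apply]
  have e1 := (Z r).toAddMonoidHom.map_finsum (nopTerm_finite (sgn (p * p)) hX hY 0 v)
  simp only [LinearMap.toAddMonoidHom_coe] at e1
  have f1 : (fun j => Z r (nopTerm (sgn (p * p)) X Y 0 j v)).HasFiniteSupport :=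
    (nopTerm_finite (sgn (p * p)) hX hY 0 v).subset fun j hj hc => hj (by simp [hc])
  have f2 : (fun j : ℤ => if j = r then β • Z r v else 0).HasFiniteSupport :=
    (Set.finite_singleton r).subset fun j hj => by
      by_contra h; exact hj (if_neg h)
  have f3 : (fun j : ℤ => if j = -1 - r then (sgn (p * p) * α) • Z r v else 0).HasFiniteSupport :=
    (Set.finite_singleton (-1 - r)).subset fun j hj => by
      by_contra h; exact hj (if_neg h)
  -- The commutator is computed summand by summand. Passing `Z_r` through both factors costs `sgn (p
  -- * q)` twice, hence nothing, and leaves one contraction term from each factor. These corrections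
  -- have the same form whichever factor stands on the left, so the cut between negative and
  -- nonnegative `j` plays no role in the result.
  have key : ∀ j, nopTerm (sgn (p * p)) X Y 0 j (Z r v) =
      Z r (nopTerm (sgn (p * p)) X Y 0 j v) + ((if j = r then β • Z r v else 0) +
        if j = -1 - r then (sgn (p * p) * α) • Z r v else 0) := by
    intro j
    -- In the summand `j` of the zero mode, `X` carries the index `j` and `Y` the index `-1 - j`.
    -- Contraction with `Z_r` requires the indices to add up to `-1`, so `Y` contributes only at `j
    -- = r` and `X` only at `j = -1 - r`. The surviving factor then has index `r` in both cases.
    have b1 : (if 0 - 1 - j + r = -1 then β else 0) = if j = r then β else 0 :=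
      if_congr (by omega) rfl rfl
    have b2 : (if j + r = -1 then α else 0) = if j = -1 - r then α else 0 :=
      if_congr (by omega) rfl rfl
    have b3 : ((if j = r then β else 0) • X j v : Fock par) =
        if j = r then β • Z r v else 0 := by
      split_ifs with h
      · rw [h, hβ]
      · rw [zero_smul]
    have b4 : ((if j = -1 - r then α else 0) • Y (0 - 1 - j) v : Fock par) =
        if j = -1 - r then α • Z r v else 0 := by
      split_ifs with h
      · rw [h, show 0 - 1 - (-1 - r) = r by ring, hα]
      · rw [zero_smul]
    have b5 : (if j = -1 - r then (sgn (p * p) * α) • Z r v else 0 : Fock par) =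
        sgn (p * p) • if j = -1 - r then α • Z r v else 0 := by
      split_ifs
      · rw [mul_smul]
      · rw [smul_zero]
    -- For `j < 0` the mode `Z_r` meets `Y` first, so the contraction with `X` carries the extra
    -- sign of passing `Y`; by `sα` this is the exchange sign of the stated correction.
    have b6 : sgn (p * q) • (if j = -1 - r then α • Z r v else 0 : Fock par) =
        sgn (p * p) • if j = -1 - r then α • Z r v else 0 := by
      split_ifs
      · rw [smul_smul, smul_smul, sα]
      · rw [smul_zero, smul_zero]
    -- For `j ≥ 0` the order of the factors is reversed: the contraction with `Y` carries the sign
    -- of passing `X`, which becomes `sgn (p * p)` and cancels against the sign in front of the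
    -- summand.
    have b7 : sgn (p * q) • (if j = r then β • Z r v else 0 : Fock par) =
        sgn (p * p) • if j = r then β • Z r v else 0 := by
      split_ifs
      · rw [smul_smul, smul_smul, sβ]
      · rw [smul_zero, smul_zero]
    simp only [nopTerm]
    by_cases hj : j < 0
    · rw [if_pos hj, if_pos hj, cY, map_add, map_smul, map_smul, cX, b1, b2, b3, b4, smul_add, smul_smul, hpq, one_smul,
        b6, b5]
      abel
    · rw [if_neg hj, if_neg hj, cX, map_add, map_smul, map_smul, cY, b1, b2, b3, b4, b5,
        smul_add (sgn (p * q)), smul_smul (sgn (p * q)), hpq, one_smul, b7, smul_add, smul_add,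
        smul_smul _ _ (ite _ _ _), hε, one_smul, map_smul]
      abel
  -- Summation over `j`: the uncontracted terms reassemble to `Z_r` applied to the zero mode, and
  -- each of the two correction terms is supported at a single index. This gives the coefficient `β
  -- + sgn (p * p) α` of `Z_r`.
  rw [finsum_congr key, finsum_add_distrib f1 ((f2.union f3).subset (Function.support_add _ _)),
    finsum_add_distrib f2 f3, ← e1, finsum_eq_single _ r fun j hj => if_neg hj,
    finsum_eq_single _ (-1 - r) fun j hj => if_neg hj, if_pos rfl, if_pos rfl, add_smul]

/-! ### The charges of the generators with respect to the shifted current -/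

/-- `D` annihilates the vacuum, so moving it past `g_(-1|1)` leaves only the supercommutator
`g_(-1|0)`. A derivative in the current thus amounts to choosing the other component of the
generator. -/
theorem D_ket (g : A × Bool) : (fermion par).D (ket par (sym par (.mode g (-1) 1))) =
    ket par (sym par (.mode g (-1) 0)) := by
  have h := act_D_one par g (-1) (ket par 1)
  rw [act_D_vac, map_zero, smul_zero, zero_add, act_ket, act_ket _ _ 1, mul_one, mul_one] at h
  exact h

/-- All products in the current have this shape: `i = 0` puts `D` on the first factor and `i = 1`
puts it on the second. -/
theorem mode_nprod_hasIntegralCharges (g : A × Bool) (i : ZMod 2) :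
    HasIntegralCharges par ((fermion par).mode ((fermion par).nprod
      (ket par (sym par (.mode g (-1) i))) (ket par (sym par (.mode (conj g) (-1) (i + 1))))) 0 1)
    := by
  rw [mode_nprod]
  exact nop_hasIntegralCharges par g i

variable [Fintype A]

/-- Taking modes is linear in the state, and the shifted current is an integral combination of
products of dual components, so integrality of the charges passes from the single products to the
current. -/
theorem chargeOp_hasIntegralCharges (t : A → ℤ) :
    HasIntegralCharges par (chargeOp par fun a => (t a : ℂ)) := by
  have hsum : ∀ f : A → Fock par,
      (∀ a, HasIntegralCharges par ((fermion par).mode (f a) 0 1)) →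
      HasIntegralCharges par ((fermion par).mode (∑ a, f a) 0 1) := by
    intro f hf
    refine Finset.sum_induction f
      (fun u => HasIntegralCharges par ((fermion par).mode u 0 1)) ?_ ?_ fun a _ => hf a
    · intro u w hu hw
      rw [map_add]
      exact hu.add hw
    · rw [map_zero]
      exact .zero
  have h0 : ∀ g, HasIntegralCharges par ((fermion par).mode ((fermion par).nprod
      ((fermion par).D (ket par (sym par (.mode g (-1) 1))))
        (ket par (sym par (.mode (conj g) (-1) 1)))) 0 1) := fun g => by
    rw [D_ket]
    exact mode_nprod_hasIntegralCharges par g 0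
  have h1 : ∀ g, HasIntegralCharges par ((fermion par).mode ((fermion par).nprod
      (ket par (sym par (.mode g (-1) 1)))
        ((fermion par).D (ket par (sym par (.mode (conj g) (-1) 1))))) 0 1) := fun g => by
    -- The second factor now has component `0`, which is `1 + 1` modulo 2, the form required of the
    -- dual component for `i = 1`.
    rw [D_ket]
    exact mode_nprod_hasIntegralCharges par g 1
  have h2 : ∀ (g) (s : ℤ), HasIntegralCharges par ((fermion par).mode ((s : ℂ) •
      ((fermion par).nprod ((fermion par).D (ket par (sym par (.mode g (-1) 1))))
        (ket par (sym par (.mode (conj g) (-1) 1))) +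
      (fermion par).nprod (ket par (sym par (.mode g (-1) 1)))
        ((fermion par).D (ket par (sym par (.mode (conj g) (-1) 1)))))) 0 1) := fun g s => by
    rw [map_smul, map_add]
    exact ((h0 g).add (h1 g)).int_smul s
  unfold chargeOp currentSh
  rw [map_add]
  -- The standard and the ghost current are treated summand by summand. The parity of `a` decides
  -- only whether `φ_a` or `φ^ā` takes the first place; the other is its conjugate.
  refine HasIntegralCharges.add (hsum _ fun a => ?_) (hsum _ fun a => ?_)
  · split_ifs
    exacts [h0 (a, false), h0 (a, true)]
  · split_ifs
    exacts [h2 (a, false) (t a), h2 (a, true) (t a)]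

/-! ### Decomposition into integral charges -/

/-- The sum of the integral eigenspaces contains the vacuum and is stable under creation operators,
each of which shifts the charge by an integer. Such a subspace is everything. -/
theorem iSup_chargeSpace (t : A → ℤ) :
    ⨆ m : ℤ, chargeSpace par (fun a => (t a : ℂ)) (m : ℂ) = ⊤ := by
  refine eq_top_iff.2 fun v _ => mem_of_neg par _ ?_ (fun g i m _ v hv => ?_) v
  -- The charge operator is the coefficient of index `0`, the lowest one that regularity of the
  -- superfield on the vacuum forces to annihilate it; so the vacuum has charge `0`.
  · refine Submodule.mem_iSup_of_mem 0 ?_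
    rw [chargeSpace, Module.End.mem_eigenspace_iff, Int.cast_zero, zero_smul]
    exact (fermion par).mode_vac _ _ le_rfl _
  · obtain ⟨c, hc⟩ := chargeOp_hasIntegralCharges par t g i
    -- A vector of the sum need not have a definite charge; linearity reduces the stability to
    -- eigenvectors, where the charge goes from `k` to `k + c`.
    induction hv using Submodule.iSup_induction' with
    | mem k v hv =>
      refine Submodule.mem_iSup_of_mem (k + c) ?_
      rw [chargeSpace, Module.End.mem_eigenspace_iff] at hv ⊢
      refine (hc m v).trans ?_
      rw [hv, map_smul, Int.cast_add, add_smul]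
      rfl
    | zero => rw [map_zero]; exact Submodule.zero_mem _
    | add v w _ _ hv hw => rw [map_add]; exact Submodule.add_mem _ hv hw

end ChargedFermion

end SUSYVA

/-- Charge decomposition. Let `U` be a finite-dimensional vector superspace with a homogeneous
basis indexed by `A`, the basis vector `a` having parity `par a`, and let `t_a`, `a ∈ A`, be
integers. The SUSY charged free fermion vertex algebra of `U` is the direct sum over `m ∈ ℤ` of its
subspaces of vectors of charge `m`. -/
theorem propositionB6 {A : Type*} [Fintype A] (par : A → ZMod 2) (t : A → ℤ) :
    DirectSum.IsInternal (fun m : ℤ =>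
      SUSYVA.ChargedFermion.chargeSpace par (fun a => (t a : ℂ)) (m : ℂ)) :=
  DirectSum.isInternal_submodule_of_iSupIndep_of_iSup_eq_top
    -- Distinct integers are distinct complex eigenvalues, so the independence of all eigenspaces
    -- restricts to the integral ones.
    ((Module.End.eigenspaces_iSupIndep _).comp Int.cast_injective)
    (SUSYVA.ChargedFermion.iSup_chargeSpace par t)
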